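/- **Definitions.** A representation of a set names each of its elements by at least one bit string, each string naming at most one element. Time is that of a deterministic oracle machine on encodings (integers in LPs in binary). A subring $A\subset\mathbb R$ (containing $1$), with a representation in which $\operatorname{size}(a)$ is the length of the name of $a$ that is given, is *efficiently computable* if: a name of $n\in\mathbb Z$ is computable in time polynomial in the bit length of $n$; $2^{-\mathrm{poly}(\operatorname{size}(a))}<a<2^{\mathrm{poly}(\operatorname{size}(a))}$ for all $a\in A$, $a>0$; the operations $+,-,\times$ and the relations $=,<$ are computable in polynomial time; and $\operatorname{size}(a\circ b)\le C(\operatorname{size}(a)+\operatorname{size}(b))$ for $\circ\in\{+,-,\times\}$. It is *LP-solvable* if moreover there is a polynomial-time algorithm that, given $M\in\mathbb Z^{r\times n}$ and $b\in\mathbb Z^r$, outputs some $x\in A^n$ with $Mx\le b$, or reports that none exists. A subring $R'$ of a commutative ring $R$ (with a representation) forms an *LE-solvable pair* $R'\subset R$ if there is a polynomial-time algorithm that, given a finite system of linear equations with coefficients in $R$, each variable of which is specified to range over $R$ or over $R'$, outputs a solution or reports that none exists. For $S\subset\mathbb Z^N$ let $\operatorname{Conv}_A(S)=\operatorname{Conv}(S)\cap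 A^N$, and for $S\subset R^N$ let $\operatorname{Aff}_{R'}(S)=\{\sum_i r_is^i: s^i\in S,\ r_i\in R',\ \sum_i r_i=1\}$ (finite sums). Let $\operatorname{LP}_{A^k}$ be the set of relations $\operatorname{Conv}_A(S)$ over the domain $A^k$, where $S\subset\mathbb Z^{k\cdot\mathrm{ar}}$ is finite, and $\operatorname{LE}_{R'\subset R}$ the set of relations $\operatorname{Aff}_{R'}(S)$ over $R$, where $S\subset R^{\mathrm{ar}}$ is finite. The direct product of sets of relations consists of the coordinatewise products of relations of equal arity. A promise template $\Gamma=(\{P_i\subseteq D^{\mathrm{ar}_i}\}_{i\in I},\{Q_i\subseteq E^{\mathrm{ar}_i}\}_{i\in I})$ over $(D,E,\phi:D\to E)$ satisfies $\phi(P_i)\subseteq Q_i$ for all $i$; it is finite if $D,E,I$ are. An instance is a formula $\bigwedge_{j}c_{i_j}(x_{j_1},\dots,x_{j_{\mathrm{ar}_{i_j}}})$ in variables $x_1,\dots,x_n$, read as $\Psi_P$ with $c_i=P_i$ and as $\Psi_Q$ with $c_i=Q_i$. The promise problem $\operatorname{PCSP}(\Gamma)$ is to accept if $\Psi_P$ is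 satisfiable and reject if $\Psi_Q$ is not. $\Gamma$ *sandwiches* a set of relations $\Lambda$ over $F$ *via* $g:D\to F$, $h:F\to E$ if there are $\Lambda_i\in\Lambda$ of arity $\mathrm{ar}_i$ $(i\in I)$ with $g(P_i)\subseteq\Lambda_i$ and $h(\Lambda_i)\subseteq Q_i$ for all $i$. $\mathsf P^h$ is the class of promise problems decidable in polynomial time with oracle access to $h$ (a query lists names of the coordinates of a point $f\in F$; the answer is $h(f)$). **Theorem.** Let $A_1,\dots,A_\ell\subset\mathbb R$ be LP-solvable rings, $R'_1\subset R_1,\dots,R'_m\subset R_m$ LE-solvable pairs, $k_1,\dots,k_\ell$ natural numbers, and $\Gamma$ a finite promise template over $(D,E,\phi)$. Assume that $\Gamma$ sandwiches $$\operatorname{LPLE}_{\mathcal A,\mathcal R}=\operatorname{LP}_{A_1^{k_1}}\times\cdots\times\operatorname{LP}_{A_\ell^{k_\ell}}\times\operatorname{LE}_{R'_1\subset R_1}\times\cdots\times\operatorname{LE}_{R'_m\subset R_m}$$ via $g:D\to\mathbb Z^{k_1}\times\cdots\times\mathbb Z^{k_\ell}\times R_1\times\cdots\times R_m$ and $h:A_1^{k_1}\times\cdots\times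 A_\ell^{k_\ell}\times R_1\times\cdots\times R_m\to E$. Then $\operatorname{PCSP}(\Gamma)\in\mathsf P^h$. Moreover, some polynomial-time algorithm with oracle access to $h$ does the following on every instance with variables $x_1,\dots,x_n$. Consider the relaxations asking for $v_{j,1},\dots,v_{j,n}\in A_j^{k_j}$ with $v_{j,i}\in\operatorname{Conv}_{A_j}(g_j(D))$ for all $i$ and $(v_{j,t_1},\dots,v_{j,t_{\mathrm{ar}}})\in\operatorname{Conv}_{A_j}(g_j(P))$ for every clause $P(x_{t_1},\dots,x_{t_{\mathrm{ar}}})$ of $\Psi_P$ $(1\le j\le\ell)$, and for $w_{j,1},\dots,w_{j,n}\in R_j$ with $(w_{j,t_1},\dots,w_{j,t_{\mathrm{ar}}})\in\operatorname{Aff}_{R'_j}(g_{\ell+j}(P))$ for every such clause $(1\le j\le m)$. If one of them has no solution, the algorithm rejects, and $\Psi_P$ is unsatisfiable; otherwise it outputs $y_i=h(v_{1,i},\dots,v_{\ell,i},w_{1,i},\dots,w_{m,i})$, $1\le i\le n$, for some solutions of all of them, and $y$ satisfies $\Psi_Q$. -/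

import Mathlib

open scoped BigOperators

namespace PromiseCSP

/-! ## Computation: while programs over binary trees, with an oracle and a size-sensitive cost -/

/-- The data on which programs work: finite binary trees (S-expressions). -/
inductive Data : Type
  | nil : Data
  | cons : Data → Data → Data

namespace Data

/-- Number of nodes; a tree with `s` nodes is described by `s` bits, and conversely. -/
def size : Data → ℕ
  | nil => 1
  | cons a b => a.size + b.size + 1

def fst : Data → Data
  | nil => nil
  | cons a _ => a

def snd : Data → Data
  | nil => nil
  | cons _ b => b

def ofBool : Bool → Data
  | false => nil
  | true => cons nil nil

def ofList : List Data → Data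
  | [] => nil
  | a :: l => cons a (ofList l)

def ofBits (w : List Bool) : Data := ofList (w.map ofBool)

/-- Natural numbers in unary. -/
def ofNat (n : ℕ) : Data := ofList (List.replicate n nil)

/-- Integers in binary: sign and binary digits of the absolute value. -/
def ofInt (z : ℤ) : Data := cons (ofBool (decide (z < 0))) (ofBits z.natAbs.bits)

def ofOption : Option Data → Data
  | none => nil
  | some d => cons nil d

end Data

/-- Deterministic while programs with an oracle instruction.  Every program acts on one tree. -/
inductive Prog : Type
  | id : Prog
  | nil : Prog
  | fst : Prog
  | snd : Prog
  | query : Prog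
  | pair : Prog → Prog → Prog
  | comp : Prog → Prog → Prog
  | ite : Prog → Prog → Prog → Prog
  | while : Prog → Prog → Prog

/-- `Runs O p x y t`: with oracle `O`, program `p` halts on input `x` with output `y` after time `t`.
Each instruction is charged the sizes of the trees it reads and writes (for an oracle call: question
and answer), so time is polynomially related to time on (oracle) Turing machines.
`comp q p` runs `p` first; `ite` and `while` take `nil` as "false". -/
inductive Runs (O : Data → Data) : Prog → Data → Data → ℕ → Prop
  | id (x : Data) : Runs O .id x x (x.size + x.size)
  | nil (x : Data) : Runs O .nil x .nil (x.size + 1)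
  | fst (x : Data) : Runs O .fst x x.fst (x.size + x.fst.size)
  | snd (x : Data) : Runs O .snd x x.snd (x.size + x.snd.size)
  | query (x : Data) : Runs O .query x (O x) (x.size + (O x).size)
  | pair {p q : Prog} {x y z : Data} {s t : ℕ} (hp : Runs O p x y s) (hq : Runs O q x z t) :
      Runs O (.pair p q) x (.cons y z) (s + t + x.size + (Data.cons y z).size)
  | comp {p q : Prog} {x y z : Data} {s t : ℕ} (hp : Runs O p x y s) (hq : Runs O q y z t) :
      Runs O (.comp q p) x z (s + t)
  | ite_true {c p q : Prog} {x a b y : Data} {s t : ℕ} (hc : Runs O c x (.cons a b) s)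
      (hp : Runs O p x y t) : Runs O (.ite c p q) x y (s + t + x.size)
  | ite_false {c p q : Prog} {x y : Data} {s t : ℕ} (hc : Runs O c x .nil s)
      (hq : Runs O q x y t) : Runs O (.ite c p q) x y (s + t + x.size)
  | while_stop {c p : Prog} {x : Data} {s : ℕ} (hc : Runs O c x .nil s) :
      Runs O (.while c p) x x (s + x.size)
  | while_step {c p : Prog} {x a b y z : Data} {s t u : ℕ} (hc : Runs O c x (.cons a b) s)
      (hp : Runs O p x y t) (hw : Runs O (.while c p) y z u) :
      Runs O (.while c p) x z (s + t + u + x.size)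

/-- Some program, in time polynomial in the input size, turns (the encoding of) every `a : α` into an
output allowed by `spec a`, whichever of the oracles in `𝒪` it is run with. -/
def PolyTimeWith (𝒪 : Set (Data → Data)) {α : Type*} (enc : α → Data)
    (spec : α → Data → Prop) : Prop :=
  ∃ (p : Prog) (T : Polynomial ℕ), ∀ O ∈ 𝒪, ∀ a : α, ∃ (y : Data) (t : ℕ),
    Runs O p (enc a) y t ∧ t ≤ T.eval (enc a).size ∧ spec a y

/-- Polynomial time without an oracle: the oracle instruction only ever returns `nil`. -/
def PolyTime {α : Type*} (enc : α → Data) (spec : α → Data → Prop) : Prop :=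
  PolyTimeWith {fun _ => Data.nil} enc spec

/-- A promise problem: accept the inputs in `yes`, reject those in `no`. -/
structure PromiseProblem where
  yes : Set Data
  no : Set Data

/-- The promise problems decidable in polynomial time with access to an oracle from `𝒪`. -/
def PWithOracle (𝒪 : Set (Data → Data)) : Set PromiseProblem :=
  {Q | ∃ (p : Prog) (T : Polynomial ℕ), ∀ O ∈ 𝒪,
    (∀ x ∈ Q.yes, ∃ t ≤ T.eval x.size, Runs O p x (Data.ofBool true) t) ∧
    (∀ x ∈ Q.no, ∃ t ≤ T.eval x.size, Runs O p x (Data.ofBool false) t)}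

/-! ## Representations of ring elements by bit strings -/

/-- A representation of the elements of `α` by bit strings: every element has at least one name, and
a bit string names at most one element. -/
structure BitRep (α : Type*) where
  decode : List Bool → Option α
  surj : ∀ a, ∃ w, decode w = some a

/-- A bit string naming an element, together with that element. -/
structure BitRep.Name {α : Type*} (ρ : BitRep α) where
  word : List Bool
  val : α
  decode_word : ρ.decode word = some val

/-- What a program sees of a name: only the bit string. -/
def BitRep.Name.enc {α : Type*} {ρ : BitRep α} (u : ρ.Name) : Data := Data.ofBits u.word

/-- A binary operation is computable in polynomial time, with names growing at most linearly. -/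
def EfficientOp {α : Type*} (ρ : BitRep α) (op : α → α → α) : Prop :=
  ∃ C : ℕ, PolyTime (fun u : ρ.Name × ρ.Name => Data.cons u.1.enc u.2.enc)
    (fun u y => ∃ v : ρ.Name, v.val = op u.1.val u.2.val ∧ y = v.enc ∧
      v.word.length ≤ C * (u.1.word.length + u.2.word.length))

open Classical in
/-- A binary predicate is decidable in polynomial time. -/
def EfficientRel {α : Type*} (ρ : BitRep α) (rel : α → α → Prop) : Prop :=
  PolyTime (fun u : ρ.Name × ρ.Name => Data.cons u.1.enc u.2.enc)
    (fun u y => y = Data.ofBool (decide (rel u.1.val u.2.val)))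

/-- Efficiently computable subrings of `ℝ` (with respect to a representation).  In `int`, the length
of the name found is polynomial in the number of digits because it is bounded by the running time. -/
structure EfficientlyComputable (A : Subring ℝ) (ρ : BitRep A) : Prop where
  int : PolyTime Data.ofInt (fun n y => ∃ u : ρ.Name, (u.val : ℝ) = n ∧ y = u.enc)
  magnitude : ∃ T : Polynomial ℕ, ∀ u : ρ.Name, (0 : ℝ) < u.val →
    (u.val : ℝ) < 2 ^ T.eval u.word.length ∧ ((2 : ℝ) ^ T.eval u.word.length)⁻¹ < u.val
  add : EfficientOp ρ (fun a b => a + b)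
  sub : EfficientOp ρ (fun a b => a - b)
  mul : EfficientOp ρ (fun a b => a * b)
  eq : EfficientRel ρ (fun a b => a = b)
  lt : EfficientRel ρ (fun a b => a < b)

/-! ## LP-solvable rings and LE-solvable pairs -/

/-- A system `M x ≤ b` of linear inequalities with integer coefficients. -/
structure LPSystem where
  rows : ℕ
  vars : ℕ
  M : Matrix (Fin rows) (Fin vars) ℤ
  b : Fin rows → ℤ

namespace LPSystem

/-- The number of variables in unary, and the rows with their coefficients in binary. -/
def enc (L : LPSystem) : Data :=
  .cons (Data.ofNat L.vars)
    (Data.ofList (List.ofFn fun i =>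
      Data.cons (Data.ofList (List.ofFn fun j => Data.ofInt (L.M i j))) (Data.ofInt (L.b i))))

def IsSolution (L : LPSystem) {A : Subring ℝ} (x : Fin L.vars → A) : Prop :=
  ∀ i, ∑ j, (L.M i j : ℝ) * (x j : ℝ) ≤ L.b i

end LPSystem

/-- `A` is LP-solvable: it is efficiently computable, and for every integer system of linear
inequalities a solution in `A` can be computed, or recognised not to exist, in polynomial time. -/
def LPSolvable (A : Subring ℝ) (ρ : BitRep A) : Prop :=
  EfficientlyComputable A ρ ∧
  PolyTime LPSystem.enc (fun L y =>
    ((¬ ∃ x : Fin L.vars → A, L.IsSolution x) ∧ y = Data.ofOption none) ∨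
    ∃ u : Fin L.vars → ρ.Name, L.IsSolution (fun j => (u j).val) ∧
      y = Data.ofOption (some (Data.ofList (List.ofFn fun j => (u j).enc))))

/-- A system `M x = b` of linear equations over `R`, given by names of its coefficients; the flagged
variables are required to take values in a subring. -/
structure LESystem {R : Type*} (σ : BitRep R) where
  rows : ℕ
  vars : ℕ
  restricted : Fin vars → Bool
  M : Matrix (Fin rows) (Fin vars) σ.Name
  b : Fin rows → σ.Name

namespace LESystem

variable {R : Type*} {σ : BitRep R}

def enc (L : LESystem σ) : Data :=
  .cons (Data.ofList (List.ofFn fun j => Data.ofBool (L.restricted j)))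
    (Data.ofList (List.ofFn fun i =>
      Data.cons (Data.ofList (List.ofFn fun j => (L.M i j).enc)) (L.b i).enc))

def IsSolution [CommRing R] (L : LESystem σ) (R' : Subring R) (x : Fin L.vars → R) : Prop :=
  (∀ i, ∑ j, (L.M i j).val * x j = (L.b i).val) ∧ ∀ j, L.restricted j = true → x j ∈ R'

end LESystem

/-- The pair `R' ⊆ R` is LE-solvable: systems of linear equations over `R`, each of whose variables
ranges over `R` or over `R'`, can be solved in polynomial time. -/
def LESolvablePair {R : Type*} [CommRing R] (R' : Subring R) (σ : BitRep R) : Prop :=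
  PolyTime (LESystem.enc (σ := σ)) (fun L y =>
    ((¬ ∃ x : Fin L.vars → R, L.IsSolution R' x) ∧ y = Data.ofOption none) ∨
    ∃ u : Fin L.vars → σ.Name, L.IsSolution R' (fun j => (u j).val) ∧
      y = Data.ofOption (some (Data.ofList (List.ofFn fun j => (u j).enc))))

/-! ## Templates, promise templates, formulas -/

/-- A template over `F` with signature `ar`. -/
abbrev Template {I : Type*} (ar : I → ℕ) (F : Type*) := ∀ i : I, Set (Fin (ar i) → F)

def IsHom {I : Type*} {ar : I → ℕ} {F G : Type*} (f : F → G) (Γ : Template ar F)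
    (Γ' : Template ar G) : Prop :=
  ∀ i, ∀ x ∈ Γ i, (fun t => f (x t)) ∈ Γ' i

/-- A promise template over the promise domain `(D, E, φ)`. -/
structure PromiseTemplate {I : Type*} (ar : I → ℕ) {D E : Type*} (φ : D → E) where
  P : Template ar D
  Q : Template ar E
  hom : IsHom φ P Q

/-- A conjunction of constraints in the variables `x_0, …, x_{n-1}`: each clause consists of a relation
symbol and the variables it is applied to. -/
structure Formula {I : Type*} (ar : I → ℕ) where
  n : ℕ
  clauses : List (Σ i : I, Fin (ar i) → Fin n)

namespace Formula

variable {I : Type*} {ar : I → ℕ}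

/-- Relation symbols are given by their (constantly many) codes, and variables by their indices in
unary, which changes the size only polynomially as there are `n` variables to be listed anyway. -/
def enc [Encodable I] (Ψ : Formula ar) : Data :=
  .cons (Data.ofNat Ψ.n) (Data.ofList (Ψ.clauses.map fun c =>
    Data.cons (Data.ofNat (Encodable.encode c.1))
      (Data.ofList (List.ofFn fun t => Data.ofNat (c.2 t)))))

/-- The assignment `x` satisfies `Ψ`, read with the relations of `Γ`. -/
def SatisfiedBy {F : Type*} (Ψ : Formula ar) (Γ : Template ar F) (x : Fin Ψ.n → F) : Prop :=
  ∀ c ∈ Ψ.clauses, (fun t => x (c.2 t)) ∈ Γ c.1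

def Satisfiable {F : Type*} (Ψ : Formula ar) (Γ : Template ar F) : Prop :=
  ∃ x : Fin Ψ.n → F, Ψ.SatisfiedBy Γ x

end Formula

/-- The promise decision problem `PCSP(Γ)`. -/
def PCSP {I : Type*} [Encodable I] {ar : I → ℕ} {D E : Type*} {φ : D → E}
    (Γ : PromiseTemplate ar φ) : PromiseProblem where
  yes := {x | ∃ Ψ : Formula ar, Ψ.Satisfiable Γ.P ∧ x = Ψ.enc}
  no := {x | ∃ Ψ : Formula ar, ¬ Ψ.Satisfiable Γ.Q ∧ x = Ψ.enc}

/-! ## Families of relations and homomorphic sandwiches -/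

/-- A set of relations over `F`, of all arities. -/
abbrev RelFamily (F : Type*) := ∀ n : ℕ, Set (Set (Fin n → F))

/-- Direct product of two sets of relations. -/
def RelFamily.prod {F G : Type*} (Λ : RelFamily F) (Λ' : RelFamily G) : RelFamily (F × G) :=
  fun n => {T | ∃ U ∈ Λ n, ∃ V ∈ Λ' n,
    T = {x | (fun t => (x t).1) ∈ U ∧ (fun t => (x t).2) ∈ V}}

/-- Direct product of a finite sequence of sets of relations. -/
def RelFamily.pi {l : ℕ} {F : Fin l → Type*} (Λ : ∀ j, RelFamily (F j)) : RelFamily (∀ j, F j) :=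
  fun n => {T | ∃ U : ∀ j, Set (Fin n → F j), (∀ j, U j ∈ Λ j n) ∧
    T = {x | ∀ j, (fun t => x t j) ∈ U j}}

/-- `Γ` homomorphically sandwiches a template formed from relations in `Λ`, via the maps `(g, h)`. -/
def SandwichesVia {I : Type*} {ar : I → ℕ} {D E F : Type*} {φ : D → E} (Γ : PromiseTemplate ar φ)
    (Λ : RelFamily F) (g : D → F) (h : F → E) : Prop :=
  ∃ Λ' : Template ar F, (∀ i, Λ' i ∈ Λ (ar i)) ∧ IsHom g Γ.P Λ' ∧ IsHom h Λ' Γ.Q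

/-- `Conv_A(S) = Conv(S) ∩ A^ι` for a set `S` of integer points. -/
def convIn (A : Subring ℝ) {ι : Type*} (S : Set (ι → ℤ)) : Set (ι → A) :=
  {x | (fun i => (x i : ℝ)) ∈ convexHull ℝ ((fun (s : ι → ℤ) (i : ι) => (s i : ℝ)) '' S)}

/-- The affine hull of `S ⊆ R^ι` with coefficients in the subring `R'`. -/
def affIn {R : Type*} [CommRing R] (R' : Subring R) {ι : Type*} (S : Set (ι → R)) :
    Set (ι → R) :=
  {x | ∃ (n : ℕ) (r : Fin n → R) (s : Fin n → ι → R), (∀ j, r j ∈ R') ∧ (∀ j, s j ∈ S) ∧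
    ∑ j, r j = 1 ∧ x = fun i => ∑ j, r j * s j i}

/-- The relations `Conv_{A^k}(S)` over the domain `A^k`, for finite sets `S` of integer points. -/
def LPFamily (A : Subring ℝ) (k : ℕ) : RelFamily (Fin k → A) :=
  fun n => {T | ∃ S : Set (Fin n × Fin k → ℤ), S.Finite ∧ T = {x | (fun q => x q.1 q.2) ∈ convIn A S}}

/-- The relations `Aff_{R'}(S)` over the domain `R`, for finite sets `S`. -/
def LEFamily {R : Type*} [CommRing R] (R' : Subring R) : RelFamily R :=
  fun n => {T | ∃ S : Set (Fin n → R), S.Finite ∧ T = affIn R' S}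

section Combined

variable {l m : ℕ} (A : Fin l → Subring ℝ) (k : Fin l → ℕ) (R : Fin m → Type*)

/-- The domain `A_1^{k_1} × ⋯ × A_l^{k_l} × R_1 × ⋯ × R_m`. -/
abbrev LPLEDomain := (∀ j : Fin l, Fin (k j) → A j) × (∀ j : Fin m, R j)

/-- The product of the families of convex and of affine relations. -/
def LPLE {R : Fin m → Type*} [∀ j, CommRing (R j)] (R' : ∀ j, Subring (R j)) :
    RelFamily (LPLEDomain A k R) :=
  RelFamily.prod (RelFamily.pi fun j => LPFamily (A j) (k j)) (RelFamily.pi fun j => LEFamily (R' j))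

/-- The inclusion of `ℤ^{k_1} × ⋯ × ℤ^{k_l} × R_1 × ⋯ × R_m` into the domain. -/
def ofIntegral {R : Fin m → Type*} (z : (∀ j : Fin l, Fin (k j) → ℤ) × (∀ j : Fin m, R j)) :
    LPLEDomain A k R :=
  (fun j a => (z.1 j a : A j), z.2)

variable {A k R}

/-- Oracles for `h`: asked with any names of the coordinates of `f`, they answer with the code of
`h f`.  (Answers to other questions are arbitrary.) -/
def OraclesFor {E : Type*} [Encodable E] (ρ : ∀ j, BitRep (A j)) (σ : ∀ j, BitRep (R j))
    (h : LPLEDomain A k R → E) : Set (Data → Data) :=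
  {O | ∀ (u : ∀ j, Fin (k j) → (ρ j).Name) (w : ∀ j, (σ j).Name),
    O (.cons (Data.ofList (List.ofFn fun j => Data.ofList (List.ofFn fun a => (u j a).enc)))
        (Data.ofList (List.ofFn fun j => (w j).enc)))
      = Data.ofNat (Encodable.encode (h (fun j a => (u j a).val, fun j => (w j).val)))}

end Combined

/-! ## The relaxations -/

/-- `v` solves the Basic LP relaxation over `A^k` of the instance `Ψ` of `CSP(P)`. -/
def BasicLPSolution {I : Type*} {ar : I → ℕ} {D : Type*} (P : Template ar D) (A : Subring ℝ) {k : ℕ}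
    (g : D → Fin k → ℤ) (Ψ : Formula ar) (v : Fin Ψ.n → Fin k → A) : Prop :=
  (∀ i, v i ∈ convIn A (Set.range g)) ∧
  ∀ c ∈ Ψ.clauses, (fun q : Fin (ar c.1) × Fin k => v (c.2 q.1) q.2) ∈
    convIn A ((fun (x : Fin (ar c.1) → D) (q : Fin (ar c.1) × Fin k) => g (x q.1) q.2) '' P c.1)

/-- `w` solves the affine relaxation with respect to `R' ⊆ R` of the instance `Ψ` of `CSP(P)`. -/
def AffineSolution {I : Type*} {ar : I → ℕ} {D : Type*} (P : Template ar D) {R : Type*} [CommRing R]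
    (R' : Subring R) (g : D → R) (Ψ : Formula ar) (w : Fin Ψ.n → R) : Prop :=
  ∀ c ∈ Ψ.clauses, (fun t => w (c.2 t)) ∈
    affIn R' ((fun (x : Fin (ar c.1) → D) (t : Fin (ar c.1)) => g (x t)) '' P c.1)

/-- `f` solves all the Basic LP relaxations and all the affine relaxations simultaneously. -/
def RelaxationSolution {I : Type*} {ar : I → ℕ} {D : Type*} (P : Template ar D) {l m : ℕ}
    (A : Fin l → Subring ℝ) (k : Fin l → ℕ) {R : Fin m → Type*} [∀ j, CommRing (R j)]
    (R' : ∀ j, Subring (R j)) (g : D → (∀ j : Fin l, Fin (k j) → ℤ) × (∀ j : Fin m, R j))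
    (Ψ : Formula ar) (f : Fin Ψ.n → LPLEDomain A k R) : Prop :=
  (∀ j, BasicLPSolution P (A j) (fun d => (g d).1 j) Ψ (fun i => (f i).1 j)) ∧
  ∀ j, AffineSolution P (R' j) (fun d => (g d).2 j) Ψ (fun i => (f i).2 j)

end PromiseCSP

open PromiseCSP

namespace PromiseCSP

universe u v

/-! ## Polynomially bounded functions and running times -/

namespace Data

/-! Correctness rests on minimality of hulls. If `x` satisfies `Ψ_P`, the points `g (x i)` solve
every relaxation (`exists_relaxationSolution`). Conversely, each `Λ_i` is in every factor a convex
or affine hull containing the image of `P_i` under `g`, so it contains the hull of that image. A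
solution of the relaxations therefore satisfies all clauses read in `Λ`, and `h` carries it into `Q`
(`RelaxationSolution.satisfiedBy`).

The relaxations must also be put in the form that the given solvers accept. Since the template is
finite, every hull in question is a constant. On the LP side, Fourier–Motzkin elimination of the
real weights describes each hull by integer inequalities in the coordinates alone
(`exists_inequalities`). This matters over a subring `A`: only the coordinates have to lie in `A`,
so keeping the weights as unknowns over `A` would ask for too much. On the affine side the weights
are required to lie in `R'`, so they stay as restricted unknowns, one block of equal length per
clause (`mem_affIn_image_iff`, `exists_uniform_enumeration`). `LPSolvable.exists_basicLP` and
`LESolvablePair.exists_affine` solve the two kinds of system; `polyTimeWith_relaxations` runs them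
all and asks the oracle for the value at each point.

Running times are handled through `PolyComputes`, a predicate on families of inputs and outputs with
a common index and a common size measure. Its closure under composition, pairing, branching, loops
and list operations lets programs be assembled without being written out. Indexing by an arbitrary
type makes restriction to a case, or passage to a loop body, a mere change of index. -/

theorem size_fst_le (x : Data) : x.fst.size ≤ x.size := by
  cases x <;> simp [size, fst]; omega

theorem size_snd_le (x : Data) : x.snd.size ≤ x.size := by
  cases x <;> simp [size, snd]; omega

theorem size_iterate_snd_le (m : ℕ) (x : Data) : (snd^[m] x).size ≤ x.size := by
  induction m generalizing x with
  | zero => simp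
  | succ m ih => exact (ih x.snd).trans x.size_snd_le

end Data

/-- Every instruction is charged for what it reads and writes, so a time bound also bounds the sizes
of input and output. Intermediate values thus need no size estimates of their own. -/
theorem Runs.size_input_le {O : Data → Data} {p : Prog} {x y : Data} {t : ℕ}
    (h : Runs O p x y t) : x.size ≤ t := by
  induction h <;> omega

theorem Runs.size_output_le {O : Data → Data} {p : Prog} {x y : Data} {t : ℕ}
    (h : Runs O p x y t) : y.size ≤ t := by
  induction h <;> (try simp only [Data.size] at *) <;> omega

/-- `t` is bounded by a polynomial in `s`. -/
def PolyBounded {α : Type*} (s t : α → ℕ) : Prop :=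
  ∃ T : Polynomial ℕ, ∀ a, t a ≤ T.eval (s a)

theorem polynomial_eval_mono (T : Polynomial ℕ) {m n : ℕ} (h : m ≤ n) : T.eval m ≤ T.eval n := by
  simp only [Polynomial.eval_eq_sum, Polynomial.sum]
  exact Finset.sum_le_sum fun i _ => Nat.mul_le_mul_left _ (Nat.pow_le_pow_left h i)

namespace PolyBounded

variable {α : Type u} {β : Type v} {s t t' : α → ℕ}

theorem self : PolyBounded s s := ⟨Polynomial.X, fun a => by simp⟩

theorem const (c : ℕ) : PolyBounded s fun _ => c := ⟨Polynomial.C c, fun a => by simp⟩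

theorem mono (h : PolyBounded s t) (hle : ∀ a, t' a ≤ t a) : PolyBounded s t' :=
  let ⟨T, hT⟩ := h
  ⟨T, fun a => (hle a).trans (hT a)⟩

theorem add (h : PolyBounded s t) (h' : PolyBounded s t') : PolyBounded s fun a => t a + t' a :=
  let ⟨T, hT⟩ := h
  let ⟨T', hT'⟩ := h'
  ⟨T + T', fun a => by simpa using Nat.add_le_add (hT a) (hT' a)⟩

theorem mul (h : PolyBounded s t) (h' : PolyBounded s t') : PolyBounded s fun a => t a * t' a :=
  let ⟨T, hT⟩ := h
  let ⟨T', hT'⟩ := h'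
  ⟨T * T', fun a => by simpa using Nat.mul_le_mul (hT a) (hT' a)⟩

theorem eval (h : PolyBounded s t) (T : Polynomial ℕ) : PolyBounded s fun a => T.eval (t a) :=
  let ⟨T', hT'⟩ := h
  ⟨T.comp T', fun a => by simpa using polynomial_eval_mono T (hT' a)⟩

theorem trans {s' : α → ℕ} (h : PolyBounded s t) (h' : PolyBounded s' s) : PolyBounded s' t :=
  let ⟨T, hT⟩ := h
  (h'.eval T).mono hT

theorem pullback (h : PolyBounded s t) (φ : β → α) :
    PolyBounded (fun b => s (φ b)) fun b => t (φ b) :=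
  let ⟨T, hT⟩ := h
  ⟨T, fun b => hT (φ b)⟩

end PolyBounded

/-- One program, run with the oracle `o a`, turns `e a` into `f a` for every `a`, in time polynomial
in `s a`. -/
def PolyComputes {α : Type u} (o : α → Data → Data) (s : α → ℕ) (e f : α → Data) : Prop :=
  ∃ (p : Prog) (T : Polynomial ℕ), ∀ a, ∃ t, Runs (o a) p (e a) (f a) t ∧ t ≤ T.eval (s a)

/-- One program decides `P a` from `e a` in time polynomial in `s a`; `nil` stands for a
negative answer. -/
def PolyDecides {α : Type u} (o : α → Data → Data) (s : α → ℕ) (e : α → Data) (P : α → Prop) :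
    Prop :=
  ∃ c : α → Data, PolyComputes o s e c ∧ ∀ a, c a ≠ .nil ↔ P a

/-! ### Closure properties of polynomial-time computable families -/

namespace PolyComputes

variable {α : Type u} {β : Type v} {o : α → Data → Data} {s : α → ℕ} {e f g : α → Data}

theorem of_time {t : α → ℕ} (p : Prog) (ht : PolyBounded s t)
    (h : ∀ a, Runs (o a) p (e a) (f a) (t a)) : PolyComputes o s e f :=
  let ⟨T, hT⟩ := ht
  ⟨p, T, fun a => ⟨t a, h a, hT a⟩⟩

theorem exists_time (h : PolyComputes o s e f) :
    ∃ (p : Prog) (t : α → ℕ), PolyBounded s t ∧ ∀ a, Runs (o a) p (e a) (f a) (t a) := by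
  obtain ⟨p, T, h⟩ := h
  choose t ht hT using h
  exact ⟨p, t, ⟨T, hT⟩, ht⟩

theorem size_input (h : PolyComputes o s e f) : PolyBounded s fun a => (e a).size :=
  let ⟨_, _, ht, h⟩ := h.exists_time
  ht.mono fun a => (h a).size_input_le

theorem size_output (h : PolyComputes o s e f) : PolyBounded s fun a => (f a).size :=
  let ⟨_, _, ht, h⟩ := h.exists_time
  ht.mono fun a => (h a).size_output_le

theorem congr (h : PolyComputes o s e f) (hfg : ∀ a, f a = g a) : PolyComputes o s e g :=
  (funext hfg : f = g) ▸ h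

/-- The program does not see the index, so any reindexing is free, even by a non-computable map. -/
theorem pullback (h : PolyComputes o s e f) (φ : β → α) :
    PolyComputes (fun b => o (φ b)) (fun b => s (φ b)) (fun b => e (φ b)) fun b => f (φ b) :=
  let ⟨p, T, h⟩ := h
  ⟨p, T, fun b => h (φ b)⟩

theorem rescale {s' : α → ℕ} (h : PolyComputes o s e f) (hs : PolyBounded s' s) :
    PolyComputes o s' e f :=
  let ⟨p, _, ht, h⟩ := h.exists_time
  of_time p (ht.trans hs) h

theorem refl (h : PolyBounded s fun a => (e a).size) : PolyComputes o s e e :=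
  of_time .id (h.add h) fun a => .id (e a)

theorem trans (h : PolyComputes o s e f) (h' : PolyComputes o s f g) : PolyComputes o s e g :=
  let ⟨p, _, ht, h⟩ := h.exists_time
  let ⟨p', _, ht', h'⟩ := h'.exists_time
  of_time (.comp p' p) (ht.add ht') fun a => .comp (h a) (h' a)

theorem fst (h : PolyComputes o s e f) : PolyComputes o s e fun a => (f a).fst :=
  h.trans (of_time .fst (h.size_output.add (h.size_output.mono fun a => (f a).size_fst_le))
    fun a => .fst (f a))

theorem snd (h : PolyComputes o s e f) : PolyComputes o s e fun a => (f a).snd :=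
  h.trans (of_time .snd (h.size_output.add (h.size_output.mono fun a => (f a).size_snd_le))
    fun a => .snd (f a))

theorem iterate_snd (h : PolyComputes o s e f) (m : ℕ) :
    PolyComputes o s e fun a => Data.snd^[m] (f a) := by
  induction m with
  | zero => exact h
  | succ m ih => simpa only [Function.iterate_succ_apply'] using ih.snd

/-- An oracle call is charged for its answer, whose length nothing else controls; hence the bound
`hs`. -/
theorem query (h : PolyComputes o s e f) (hs : PolyBounded s fun a => (o a (f a)).size) :
    PolyComputes o s e fun a => o a (f a) :=
  h.trans (of_time .query (h.size_output.add hs) fun a => .query (f a))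

theorem nil (h : PolyBounded s fun a => (e a).size) : PolyComputes o s e fun _ => .nil :=
  of_time .nil (h.add (.const 1)) fun a => .nil (e a)

theorem cons (hf : PolyComputes o s e f) (hg : PolyComputes o s e g) :
    PolyComputes o s e fun a => .cons (f a) (g a) :=
  let ⟨p, _, ht, hp⟩ := hf.exists_time
  let ⟨q, _, ht', hq⟩ := hg.exists_time
  of_time (.pair p q) (((ht.add ht').add hf.size_input).add
    ((hf.size_output.add hg.size_output).add (.const 1))) fun a => .pair (hp a) (hq a)

theorem const (h : PolyBounded s fun a => (e a).size) (d : Data) :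
    PolyComputes o s e fun _ => d := by
  induction d with
  | nil => exact nil h
  | cons a b iha ihb => exact iha.cons ihb

/-- Decide a property first, then go on separately in the two cases. -/
theorem cases_prop {P : α → Prop} (hP : PolyDecides o s e P)
    (hf : PolyComputes (fun a : {a // P a} => o a) (fun a => s a) (fun a => e a) fun a => f a)
    (hg : PolyComputes (fun a : {a // ¬ P a} => o a) (fun a => s a) (fun a => e a) fun a => f a) :
    PolyComputes o s e f := by
  obtain ⟨c, hc, hP⟩ := hP
  obtain ⟨c', Tc, hc⟩ := hc
  obtain ⟨p, T, hp⟩ := hf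
  obtain ⟨q, T', hq⟩ := hg
  -- `T + T'` covers whichever branch is taken; the second `Tc` pays the charge for the size of the
  -- input, which is at most the time of the test.
  refine ⟨.ite c' p q, Tc + (T + T') + Tc, fun a => ?_⟩
  obtain ⟨t, ht, htT⟩ := hc a
  have hx := ht.size_input_le
  by_cases ha : P a
  · obtain ⟨t', ht', htT'⟩ := hp ⟨a, ha⟩
    have htT' : t' ≤ T.eval (s a) := htT'
    have := (hP a).2 ha
    rcases hca : c a with _ | ⟨u, v⟩
    · exact absurd hca this
    · refine ⟨_, .ite_true (hca ▸ ht) ht', ?_⟩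
      simp only [Polynomial.eval_add]
      omega
  · obtain ⟨t', ht', htT'⟩ := hq ⟨a, ha⟩
    have htT' : t' ≤ T'.eval (s a) := htT'
    have : c a = .nil := by
      by_contra h
      exact ha ((hP a).1 h)
    refine ⟨_, .ite_false (this ▸ ht) ht', ?_⟩
    simp only [Polynomial.eval_add]
    omega

theorem ite {P : α → Prop} [DecidablePred P] (hP : PolyDecides o s e P)
    (hf : PolyComputes o s e f) (hg : PolyComputes o s e g) :
    PolyComputes o s e fun a => if P a then f a else g a := by
  refine cases_prop hP ((hf.pullback _).congr fun a => ?_) ((hg.pullback _).congr fun a => ?_)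
  · rw [if_pos a.2]
  · rw [if_neg a.2]

/-- A `while` loop with polynomially many rounds, each taking polynomial time. -/
theorem loop {N : α → ℕ} {st c : α → ℕ → Data} (hN : PolyBounded s N)
    (hc : PolyComputes (fun z : Σ a, Fin (N a + 1) => o z.1) (fun z => s z.1)
      (fun z => st z.1 z.2) fun z => c z.1 z.2)
    (hcN : ∀ a, ∀ i ≤ N a, c a i = .nil ↔ i = N a)
    (hb : PolyComputes (fun z : Σ a, Fin (N a) => o z.1) (fun z => s z.1)
      (fun z => st z.1 z.2) fun z => st z.1 (z.2 + 1)) :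
    PolyComputes o s (fun a => st a 0) fun a => st a (N a) := by
  obtain ⟨p, T, hc⟩ := hc
  obtain ⟨q, T', hb⟩ := hb
  obtain ⟨S, hN⟩ := hN
  -- Induction on the number `d` of rounds left. The bounds are in terms of `s a` and not of the
  -- current state, so they do not compound over the rounds. The second `T` pays for reading the
  -- state, and `d + 1` includes the final failing test.
  have key : ∀ a d i, i + d = N a → ∃ t,
      Runs (o a) (.while p q) (st a i) (st a (N a)) t ∧
        t ≤ (d + 1) * (T.eval (s a) + T'.eval (s a) + T.eval (s a)) := by
    intro a d
    induction d with
    | zero =>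
      intro i hi
      obtain ⟨t, ht, hT⟩ := hc ⟨a, ⟨i, by omega⟩⟩
      have hi : i = N a := hi
      have hx := ht.size_input_le
      simp only [(hcN a i hi.le).2 hi] at ht
      subst hi
      refine ⟨_, Runs.while_stop ht, ?_⟩
      simp only at hT hx ⊢
      omega
    | succ d ih =>
      intro i hi
      obtain ⟨t, ht, hT⟩ := hc ⟨a, ⟨i, by omega⟩⟩
      obtain ⟨t', ht', hT'⟩ := hb ⟨a, ⟨i, by omega⟩⟩
      obtain ⟨t'', ht'', hT''⟩ := ih (i + 1) (by omega)
      have hx := ht.size_input_le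
      have hne : c a i ≠ .nil := fun h => by
        have := (hcN a i (by omega)).1 h
        omega
      rcases hca : c a i with _ | ⟨u, v⟩
      · exact absurd hca hne
      · simp only [hca] at ht
        refine ⟨_, .while_step ht ht' ht'', ?_⟩
        simp only at hT hx hT' ⊢
        rw [add_mul _ 1]
        omega
  refine ⟨.while p q, (S + 1) * (T + T' + T), fun a => ?_⟩
  obtain ⟨t, ht, hT⟩ := key a (N a) 0 (by omega)
  refine ⟨t, ht, hT.trans ?_⟩
  simp only [Polynomial.eval_mul, Polynomial.eval_add, Polynomial.eval_one]
  exact Nat.mul_le_mul_right _ (Nat.add_le_add_right (hN a) 1)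

end PolyComputes

/-! ## Running a program without its oracle -/

/-- Replace all oracle calls by the answer `nil`. -/
def Prog.withoutOracle : Prog → Prog
  | .query => .nil
  | .pair p q => .pair p.withoutOracle q.withoutOracle
  | .comp p q => .comp p.withoutOracle q.withoutOracle
  | .ite c p q => .ite c.withoutOracle p.withoutOracle q.withoutOracle
  | .while c p => .while c.withoutOracle p.withoutOracle
  | .id => .id
  | .nil => .nil
  | .fst => .fst
  | .snd => .snd

/-- A query answered by `nil` costs exactly what the instruction `nil` costs, so even the running
time is unchanged. -/
theorem Runs.withoutOracle {p : Prog} {x y : Data} {t : ℕ}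
    (h : Runs (fun _ => Data.nil) p x y t) (O : Data → Data) :
    Runs O p.withoutOracle x y t := by
  induction h with
  | id x => exact .id x
  | nil x => exact .nil x
  | fst x => exact .fst x
  | snd x => exact .snd x
  | query x => exact .nil x
  | pair _ _ h₁ h₂ => exact .pair h₁ h₂
  | comp _ _ h₁ h₂ => exact .comp h₁ h₂
  | ite_true _ _ h₁ h₂ => exact .ite_true h₁ h₂
  | ite_false _ _ h₁ h₂ => exact .ite_false h₁ h₂
  | while_stop _ h₁ => exact Runs.while_stop h₁
  | while_step _ _ _ h₁ h₂ h₃ => exact .while_step h₁ h₂ h₃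

/-- Once its queries are removed, the program gives the same output with every oracle. A solver thus
becomes a single function `y`, usable as a subroutine of oracle programs. -/
theorem PolyTime.exists_output {X : Type u} {enc : X → Data} {spec : X → Data → Prop}
    (h : PolyTime enc spec) : ∃ y : X → Data, (∀ x, spec x (y x)) ∧
      PolyComputes (fun z : (Data → Data) × X => z.1) (fun z => (enc z.2).size)
        (fun z => enc z.2) fun z => y z.2 := by
  obtain ⟨p, T, h⟩ := h
  choose y t ht hT hy using h _ rfl
  exact ⟨y, hy, p.withoutOracle, T, fun z => ⟨t z.2, (ht z.2).withoutOracle z.1, hT z.2⟩⟩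

/-- An instance produced in polynomial time has polynomial size, so the solver's time bound
composes. -/
theorem PolyComputes.solve {α : Type u} {X : Type v} {o : α → Data → Data} {s : α → ℕ}
    {e : α → Data} {enc : X → Data} {y : X → Data}
    (hy : PolyComputes (fun z : (Data → Data) × X => z.1) (fun z => (enc z.2).size)
        (fun z => enc z.2) fun z => y z.2)
    {x : α → X} (h : PolyComputes o s e fun a => enc (x a)) :
    PolyComputes o s e fun a => y (x a) :=
  h.trans ((hy.pullback fun a => (o a, x a)).rescale h.size_output)

theorem PolyComputes.polyTimeWith {X : Type u} {𝒪 : Set (Data → Data)} {enc : X → Data}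
    {spec : X → Data → Prop} {f : 𝒪 × X → Data}
    (h : PolyComputes (fun z : 𝒪 × X => z.1) (fun z => (enc z.2).size) (fun z => enc z.2) f)
    (hf : ∀ z, spec z.2 (f z)) : PolyTimeWith 𝒪 enc spec := by
  obtain ⟨p, T, h⟩ := h
  refine ⟨p, T, fun O hO x => ?_⟩
  obtain ⟨t, ht, hT⟩ := h (⟨O, hO⟩, x)
  exact ⟨_, t, ht, hT, hf (⟨O, hO⟩, x)⟩

/-! ## Programs for lists -/

namespace Data

theorem fst_cons (a b : Data) : (cons a b).fst = a := rfl

theorem snd_cons (a b : Data) : (cons a b).snd = b := rfl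

theorem size_ofList (L : List Data) : (ofList L).size = (L.map fun d => d.size + 1).sum + 1 := by
  induction L with
  | nil => rfl
  | cons a L ih => simp only [ofList, size, ih, List.map_cons, List.sum_cons]; omega

theorem iterate_snd_nil (m : ℕ) : snd^[m] nil = nil := Function.iterate_fixed rfl m

theorem iterate_snd_ofList (m : ℕ) (L : List Data) : snd^[m] (ofList L) = ofList (L.drop m) := by
  induction m generalizing L with
  | zero => rfl
  | succ m ih =>
    cases L with
    | nil => exact iterate_snd_nil _
    | cons a L => exact ih L

theorem ofNat_succ (n : ℕ) : ofNat (n + 1) = cons nil (ofNat n) := rfl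

theorem ofNat_eq_nil {n : ℕ} : ofNat n = nil ↔ n = 0 := by
  cases n <;> simp [ofNat_succ]; rfl

theorem size_ofNat (n : ℕ) : (ofNat n).size = 2 * n + 1 := by
  simp [ofNat, size_ofList, size, mul_comm]

theorem iterate_snd_ofNat (m n : ℕ) : snd^[m] (ofNat n) = ofNat (n - m) := by
  simp [ofNat, iterate_snd_ofList]

theorem snd_ofNat (n : ℕ) : (ofNat n).snd = ofNat (n - 1) := iterate_snd_ofNat 1 n

theorem fst_iterate_snd_ofFn {n : ℕ} (F : Fin n → Data) (i : Fin n) :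
    (snd^[(i : ℕ)] (ofList (List.ofFn F))).fst = F i := by
  rw [iterate_snd_ofList, List.drop_eq_getElem_cons (by simp)]
  simp [ofList, fst]

theorem ofList_eq_nil {L : List Data} : ofList L = nil ↔ L = [] := by
  cases L <;> simp [ofList]

theorem size_ofList_append (L L' : List Data) :
    (ofList (L ++ L')).size ≤ (ofList L).size + (ofList L').size := by
  simp only [size_ofList, List.map_append, List.sum_append]
  omega

theorem size_ofList_le_of_subperm {L L' : List Data} (h : L.Subperm L') :
    (ofList L).size ≤ (ofList L').size := by
  obtain ⟨L'', hp, hs⟩ := h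
  simp only [size_ofList]
  rw [← (hp.map _).sum_eq]
  exact Nat.add_le_add_right ((hs.map _).sum_le_sum fun _ _ => Nat.zero_le _) 1

theorem size_ofList_flatMap_le {β : Type*} (L : List β) (F : β → List Data) (B : ℕ)
    (hF : ∀ b, (ofList (F b)).size ≤ B) : (ofList (L.flatMap F)).size ≤ L.length * B + 1 := by
  induction L with
  | nil => simp [ofList, size]
  | cons b L ih =>
    have := size_ofList_append (F b) (L.flatMap F)
    have := hF b
    simp only [size_ofList, List.map_append, List.sum_append, List.flatMap_cons,
      List.length_cons, add_mul] at *
    omega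

end Data

/-! ### Closure properties of decidable families -/

namespace PolyDecides

variable {α : Type u} {β : Type v} {o : α → Data → Data} {s : α → ℕ} {e : α → Data}

theorem of_computes {c : α → Data} (h : PolyComputes o s e c) :
    PolyDecides o s e fun a => c a ≠ .nil := ⟨c, h, fun _ => Iff.rfl⟩

theorem congr {P Q : α → Prop} (h : PolyDecides o s e P) (hPQ : ∀ a, P a ↔ Q a) :
    PolyDecides o s e Q :=
  (funext fun a => propext (hPQ a) : P = Q) ▸ h

theorem pullback {P : α → Prop} (h : PolyDecides o s e P) (φ : β → α) :
    PolyDecides (fun b => o (φ b)) (fun b => s (φ b)) (fun b => e (φ b)) fun b => P (φ b) :=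
  let ⟨_, hc, hP⟩ := h
  ⟨_, hc.pullback φ, fun b => hP (φ b)⟩

theorem and {P Q : α → Prop} (hP : PolyDecides o s e P) (hQ : PolyDecides o s e Q) :
    PolyDecides o s e fun a => P a ∧ Q a := by
  classical
  obtain ⟨c, hc, hcQ⟩ := hQ
  refine ⟨_, PolyComputes.ite hP hc (.nil hc.size_input), fun a => ?_⟩
  by_cases h : P a <;> simp [h, hcQ a]

theorem not {P : α → Prop} (hP : PolyDecides o s e P) :
    PolyDecides o s e fun a => ¬ P a := by
  classical
  obtain ⟨_, hc, _⟩ := id hP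
  refine ⟨_, PolyComputes.ite hP (.nil hc.size_input) (.const hc.size_input (.cons .nil .nil)),
    fun a => ?_⟩
  by_cases h : P a <;> simp [h]

theorem forall_fin (he : PolyBounded s fun a => (e a).size) {n : ℕ} {P : Fin n → α → Prop}
    (h : ∀ j, PolyDecides o s e (P j)) : PolyDecides o s e fun a => ∀ j, P j a := by
  induction n with
  | zero => exact (of_computes (.const he (.cons .nil .nil))).congr fun a => by simp
  | succ n ih =>
    exact ((h 0).and (ih fun j => h j.succ)).congr fun a =>
      (Fin.forall_fin_succ (P := fun j => P j a)).symm

end PolyDecides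

namespace PolyComputes

variable {α : Type u} {o : α → Data → Data} {s : α → ℕ} {e f : α → Data}

/-- A loop counts the unary `i` down and drops `k` entries per round. It serves as list access (`k =
1`), as access to the `i`-th block of length `k`, and, applied to a unary number, as truncated
subtraction. -/
theorem iterate_snd_mul (k : ℕ) {d : α → Data} {i : α → ℕ} (hd : PolyComputes o s e d)
    (hi : PolyComputes o s e fun a => .ofNat (i a)) :
    PolyComputes o s e fun a => Data.snd^[k * i a] (d a) := by
  let st : α → ℕ → Data := fun a j => .cons (Data.snd^[k * j] (d a)) (.ofNat (i a - j))
  have hst : PolyBounded (fun z : α × ℕ => s z.1) fun z => (st z.1 z.2).size := by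
    refine ((((hd.size_output.add hi.size_output).add (.const 1)).pullback
      (fun z : α × ℕ => z.1)).mono fun z => ?_)
    have := Data.size_iterate_snd_le (k * z.2) (d z.1)
    simp only [st, Data.size, Data.size_ofNat]
    omega
  have h := loop (o := o) (s := s) (N := i) (st := st) (c := fun a j => .ofNat (i a - j))
    (hi.size_output.mono fun a => by rw [Data.size_ofNat]; omega)
    (refl (hst.pullback fun z : Σ a, Fin (i a + 1) => (z.1, z.2))).snd
    (fun a j hj => by rw [Data.ofNat_eq_nil]; omega)
    (by
      have h := refl (o := fun z => o z.1) (hst.pullback fun z : Σ a, Fin (i a) => (z.1, z.2))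
      refine ((h.fst.iterate_snd k).cons h.snd.snd).congr fun z => ?_
      simp only [st, Data.fst_cons, Data.snd_cons, Data.snd_ofNat, ← Function.iterate_add_apply]
      congr 2
      rw [mul_add, mul_one, add_comm])
  exact ((hd.cons hi).congr (g := fun a => st a 0) fun a => rfl).trans h |>.fst

theorem nth_ofFn {n : α → ℕ} {F : ∀ a, Fin (n a) → Data} {i : ∀ a, Fin (n a)}
    (hF : PolyComputes o s e fun a => .ofList (List.ofFn (F a)))
    (hi : PolyComputes o s e fun a => .ofNat (i a)) :
    PolyComputes o s e fun a => F a (i a) :=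
  (iterate_snd_mul 1 hF hi).fst.congr fun a => by rw [one_mul, Data.fst_iterate_snd_ofFn]

theorem nth_const {n : ℕ} {F : α → Fin n → Data} (i : Fin n)
    (hF : PolyComputes o s e fun a => .ofList (List.ofFn (F a))) :
    PolyComputes o s e fun a => F a i :=
  (hF.iterate_snd i).fst.congr fun a => by rw [Data.fst_iterate_snd_ofFn]

/-- Two numbers agree when both truncated differences vanish. -/
theorem decides_eq {i j : α → ℕ} (hi : PolyComputes o s e fun a => .ofNat (i a))
    (hj : PolyComputes o s e fun a => .ofNat (j a)) : PolyDecides o s e fun a => i a = j a := by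
  refine ((PolyDecides.of_computes (iterate_snd_mul 1 hi hj)).not.and
    (PolyDecides.of_computes (iterate_snd_mul 1 hj hi)).not).congr fun a => ?_
  simp only [one_mul, Data.iterate_snd_ofNat, ne_eq, Data.ofNat_eq_nil, not_not]
  omega

/-- Moving heads from one list onto the other is the natural loop and reverses the first list; doing
it twice gives `append`. -/
theorem reverse_append {L L' : α → List Data} (h : PolyComputes o s e fun a => .ofList (L a))
    (h' : PolyComputes o s e fun a => .ofList (L' a)) :
    PolyComputes o s e fun a => .ofList ((L a).reverse ++ L' a) := by
  let st : α → ℕ → Data := fun a j =>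
    .cons (.ofList ((L a).drop j)) (.ofList (((L a).take j).reverse ++ L' a))
  have hst : PolyBounded (fun z : α × ℕ => s z.1) fun z => (st z.1 z.2).size := by
    refine ((((h.size_output.add (h.size_output.add h'.size_output)).add (.const 1)).pullback
      (fun z : α × ℕ => z.1)).mono fun z => ?_)
    have := Data.size_ofList_append (((L z.1).take z.2).reverse) (L' z.1)
    have := Data.size_ofList_le_of_subperm
      ((List.reverse_perm ((L z.1).take z.2)).subperm.trans (List.take_sublist _ _).subperm)
    have := Data.size_ofList_le_of_subperm (List.drop_sublist z.2 (L z.1)).subperm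
    simp only [st, Data.size]
    omega
  have h := loop (o := o) (s := s) (N := fun a => (L a).length) (st := st)
    (c := fun a j => .ofList ((L a).drop j))
    (h.size_output.mono fun a => by
      rw [Data.size_ofList]
      have := List.length_le_sum_of_one_le ((L a).map fun d => d.size + 1) (by simp)
      simp only [List.length_map] at this
      omega)
    (refl (hst.pullback fun z : Σ a, Fin ((L a).length + 1) => (z.1, z.2))).fst
    (fun a j hj => by rw [Data.ofList_eq_nil, List.drop_eq_nil_iff]; omega)
    (by
      have h := refl (o := fun z => o z.1)
        (hst.pullback fun z : Σ a, Fin (L a).length => (z.1, z.2))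
      refine (h.fst.snd.cons (h.fst.fst.cons h.snd)).congr fun z => ?_
      simp only [st, Data.fst_cons, Data.snd_cons]
      rw [List.drop_eq_getElem_cons z.2.2, List.take_succ_eq_append_getElem z.2.2]
      simp only [Data.ofList, Data.fst_cons, Data.snd_cons, List.reverse_append,
        List.reverse_singleton, List.nil_append, List.cons_append])
  refine (((‹PolyComputes o s e fun a => .ofList (L a)›.cons h').congr
    (g := fun a => st a 0) fun a => by simp [st]).trans h).snd.congr fun a => ?_
  simp [st, Data.snd_cons]

theorem append {L L' : α → List Data} (h : PolyComputes o s e fun a => .ofList (L a))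
    (h' : PolyComputes o s e fun a => .ofList (L' a)) :
    PolyComputes o s e fun a => .ofList (L a ++ L' a) :=
  (((h.reverse_append (L' := fun _ => []) (.nil h.size_input)).congr
    fun a => by rw [List.append_nil]).reverse_append h').congr fun a => by rw [List.reverse_reverse]

/-- The loop treats the indices in decreasing order and prepends each block to the accumulator,
which yields the right order. The state retains `e a`, so that the body can be run on `e a` together
with an index. -/
theorem flatMap {N : α → ℕ} {F : ∀ a, Fin (N a) → List Data}
    (hN : PolyComputes o s e fun a => .ofNat (N a))
    (hF : PolyComputes (fun z : Σ a, Fin (N a) => o z.1) (fun z => s z.1)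
      (fun z => .cons (e z.1) (.ofNat z.2)) fun z => .ofList (F z.1 z.2)) :
    PolyComputes o s e fun a => .ofList ((List.finRange (N a)).flatMap (F a)) := by
  let acc : ∀ a, ℕ → List Data := fun a j =>
    ((List.finRange (N a)).drop (N a - j)).flatMap (F a)
  let st : α → ℕ → Data := fun a j =>
    .cons (e a) (.cons (.ofNat (N a - j)) (.ofList (acc a j)))
  have hNs : PolyBounded s N := hN.size_output.mono fun a => by rw [Data.size_ofNat]; omega
  have hst : PolyBounded (fun z : α × ℕ => s z.1) fun z => (st z.1 z.2).size := by
    -- The accumulator holds at most `N a` blocks, each of size at most `T.eval (s a)`.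
    obtain ⟨T, hT⟩ := hF.size_output
    refine ((((hN.size_input.add hN.size_output).add ((hNs.mul
      (.eval .self T)).add (.const 3))).pullback (fun z : α × ℕ => z.1)).mono fun z => ?_)
    have h₁ := Data.size_ofList_flatMap_le ((List.finRange (N z.1)).drop (N z.1 - z.2)) (F z.1)
      (T.eval (s z.1)) fun i => hT ⟨z.1, i⟩
    have h₂ : ((List.finRange (N z.1)).drop (N z.1 - z.2)).length * T.eval (s z.1) ≤
        N z.1 * T.eval (s z.1) :=
      Nat.mul_le_mul_right _ (by rw [List.length_drop, List.length_finRange]; omega)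
    simp only [st, acc, Data.size, Data.size_ofNat]
    omega
  have h := loop (o := o) (s := s) (N := N) (st := st) (c := fun a j => .ofNat (N a - j)) hNs
    (refl (hst.pullback fun z : Σ a, Fin (N a + 1) => (z.1, z.2))).snd.fst
    (fun a j hj => by rw [Data.ofNat_eq_nil]; omega)
    (by
      have h := refl (o := fun z => o z.1) (hst.pullback fun z : Σ a, Fin (N a) => (z.1, z.2))
      have hstep := hF.pullback fun z : Σ a, Fin (N a) =>
        (⟨z.1, ⟨N z.1 - (z.2 + 1), by have := z.2.2; omega⟩⟩ : Σ a, Fin (N a))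
      have hin := (h.fst.cons h.snd.fst.snd).congr
        (g := fun z => .cons (e z.1) (.ofNat (N z.1 - (z.2 + 1)))) fun z => by
          simp only [st, Data.fst_cons, Data.snd_cons, Data.snd_ofNat, Nat.sub_sub]
      have hacc := h.snd.snd.congr (g := fun z => .ofList (acc z.1 z.2)) fun z => rfl
      refine (h.fst.cons (h.snd.fst.snd.cons
        ((hin.trans hstep).append hacc))).congr fun z => ?_
      simp only [st, Data.fst_cons, Data.snd_cons, Data.snd_ofNat, Nat.sub_sub]
      congr 3
      have hlt := z.2.2
      simp only [acc]
      rw [List.drop_eq_getElem_cons (i := N z.1 - (z.2 + 1)) (by simp; omega), List.flatMap_cons,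
        List.getElem_finRange, show N z.1 - (z.2 + 1) + 1 = N z.1 - z.2 by omega]
      rfl)
  refine ((((refl hN.size_input).cons (hN.cons (.nil hN.size_input))).congr
    (g := fun a => st a 0) fun a => ?_).trans h).snd.snd.congr fun a => ?_
  · simp [st, acc, Data.ofList, List.drop_of_length_le]
  · simp [st, acc, Data.snd_cons]

theorem ofFn {N : α → ℕ} {F : ∀ a, Fin (N a) → Data}
    (hN : PolyComputes o s e fun a => .ofNat (N a))
    (hF : PolyComputes (fun z : Σ a, Fin (N a) => o z.1) (fun z => s z.1)
      (fun z => .cons (e z.1) (.ofNat z.2)) fun z => F z.1 z.2) :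
    PolyComputes o s e fun a => .ofList (List.ofFn (F a)) :=
  (flatMap hN ((hF.cons (.nil hF.size_input)).congr
    (g := fun z => .ofList [F z.1 z.2]) fun z => rfl)).congr fun a => by
      rw [List.ofFn_eq_map, List.map_eq_flatMap]

/-- The list is independent of the input, so the program is unrolled along it, and its entries may
need unrelated programs. -/
theorem list_map {γ : Type*} (L : List γ) {F : γ → α → Data}
    (he : PolyBounded s fun a => (e a).size) (h : ∀ c ∈ L, PolyComputes o s e (F c)) :
    PolyComputes o s e fun a => .ofList (L.map fun c => F c a) := by
  induction L with
  | nil => exact .nil he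
  | cons c L ih =>
    exact (h c (by simp)).cons (ih fun c' hc' => h c' (by simp [hc']))

theorem list_ofFn {n : ℕ} {F : Fin n → α → Data}
    (he : PolyBounded s fun a => (e a).size) (h : ∀ i, PolyComputes o s e (F i)) :
    PolyComputes o s e fun a => .ofList (List.ofFn fun i => F i a) :=
  (list_map (List.finRange n) he fun i _ => h i).congr fun a => by rw [List.ofFn_eq_map]

theorem length {L : α → List Data} (h : PolyComputes o s e fun a => .ofList (L a)) :
    PolyComputes o s e fun a => .ofNat (L a).length := by
  let st : α → ℕ → Data := fun a j => .cons (.ofList ((L a).drop j)) (.ofNat j)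
  have hl : PolyBounded s fun a => (L a).length := h.size_output.mono fun a => by
    rw [Data.size_ofList]
    have := List.length_le_sum_of_one_le ((L a).map fun d => d.size + 1) (by simp)
    simp only [List.length_map] at this
    omega
  have hst : PolyBounded (fun z : Σ a, Fin ((L a).length + 1) => s z.1)
      fun z => (st z.1 z.2).size := by
    refine (((h.size_output.add (((PolyBounded.const 2).mul hl).add (.const 2))).pullback
      (fun z : Σ a, Fin ((L a).length + 1) => z.1)).mono fun z => ?_)
    have := Data.size_ofList_le_of_subperm (List.drop_sublist z.2 (L z.1)).subperm
    have := z.2.2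
    simp only [st, Data.size, Data.size_ofNat]
    omega
  have hloop := loop (o := o) (s := s) (N := fun a => (L a).length) (st := st)
    (c := fun a j => .ofList ((L a).drop j)) hl (refl hst).fst
    (fun a j hj => by rw [Data.ofList_eq_nil, List.drop_eq_nil_iff]; omega)
    (by
      have h := refl (o := fun z => o z.1) (hst.pullback fun z : Σ a, Fin (L a).length =>
        (⟨z.1, z.2.castSucc⟩ : Σ a, Fin ((L a).length + 1)))
      refine (h.fst.snd.cons ((nil h.size_input).cons h.snd)).congr fun z => ?_
      simp only [st, Data.fst_cons, Data.snd_cons, Fin.val_castSucc]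
      rw [List.drop_eq_getElem_cons z.2.2]
      rfl)
  exact (((h.cons (.nil h.size_input)).congr
    (g := fun a => st a 0) fun a => rfl).trans hloop).snd

/-- Distinguish finitely many cases by comparing codes. -/
theorem cases_encode {γ : Type*} [Finite γ] [Encodable γ] {c : α → γ}
    (hc : PolyComputes o s e fun a => .ofNat (Encodable.encode (c a)))
    (h : ∀ i, PolyComputes (fun a : {a // c a = i} => o a) (fun a => s a) (fun a => e a)
      fun a => f a) : PolyComputes o s e f := by
  have key : ∀ L : List γ, PolyComputes (fun a : {a // c a ∈ L} => o a) (fun a => s a)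
      (fun a => e a) fun a => f a := by
    intro L
    induction L with
    -- No input falls under an empty list of cases, so any program will do.
    | nil => exact ⟨.nil, 0, fun a => absurd a.2 (by simp)⟩
    | cons i L ih =>
      refine cases_prop (P := fun a => c a = i) ?_
        ((h i).pullback fun a : {a : {a // c a ∈ i :: L} // c a = i} => ⟨a.1.1, a.2⟩)
        (ih.pullback fun a : {a : {a // c a ∈ i :: L} // ¬ c a = i} =>
          ⟨a.1.1, (List.mem_cons.1 a.1.2).resolve_left a.2⟩)
      exact ((hc.decides_eq (.const hc.size_input (.ofNat (Encodable.encode i)))).congr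
        (Q := fun a => c a = i) fun a => Encodable.encode_injective.eq_iff).pullback
          fun a : {a // c a ∈ i :: L} => a.1
  have := Fintype.ofFinite γ
  exact (key Finset.univ.toList).pullback fun a => ⟨a, by simp⟩

end PolyComputes

/-! ## Convex hulls of finitely many integer points -/

theorem exists_between_finite {U V : Set ℝ} (hU : U.Finite) (hV : V.Finite)
    (h : ∀ v ∈ V, ∀ w ∈ U, v ≤ w) : ∃ y, (∀ v ∈ V, v ≤ y) ∧ ∀ w ∈ U, y ≤ w := by
  rcases V.eq_empty_or_nonempty with rfl | hV'
  · obtain ⟨y, hy⟩ := hU.bddBelow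
    exact ⟨y, by simp, fun w hw => hy hw⟩
  · rcases U.eq_empty_or_nonempty with rfl | hU'
    · obtain ⟨y, hy⟩ := hV.bddAbove
      exact ⟨y, fun w hw => hy hw, by simp⟩
    · obtain ⟨y, h₁, h₂⟩ := exists_between_of_forall_le hV' hU' h
      exact ⟨y, h₁, h₂⟩

/-- Fourier–Motzkin elimination of one real variable from inequalities with integer coefficients. -/
theorem exists_eliminate_one {X C : Type*} [AddCommGroup C] (ev : X → C →+ ℝ) (L : List (C × ℤ)) :
    ∃ L' : List C, ∀ x, (∃ y : ℝ, ∀ c ∈ L, ev x c.1 + c.2 * y ≤ 0) ↔ ∀ c ∈ L', ev x c ≤ 0 := by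
  classical
  -- Keep the inequalities free of `y`, and from `a + k y ≤ 0` with `k > 0` and `b + k' y ≤ 0` with
  -- `k' < 0` form `k b - k' a ≤ 0`, where `y` cancels. Multiplying crosswise instead of dividing
  -- keeps the coefficients integral.
  refine ⟨(L.filter fun c => c.2 = 0).map Prod.fst ++
    ((L.product L).filter fun p => 0 < p.1.2 ∧ p.2.2 < 0).map
      fun p => p.1.2 • p.2.1 - p.2.2 • p.1.1, fun x => ⟨?_, ?_⟩⟩
  · rintro ⟨y, hy⟩ c hc
    simp only [List.mem_append, List.mem_map, List.mem_filter, decide_eq_true_eq,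
      List.pair_mem_product, Prod.exists] at hc
    rcases hc with ⟨a, b, ⟨h, rfl⟩, rfl⟩ | ⟨a, k, b, k', ⟨⟨ha, hb⟩, hk, hk'⟩, rfl⟩
    · simpa using hy _ h
    · have h₁ := hy _ ha
      have h₂ := hy _ hb
      have hk : (0 : ℝ) < k := by exact_mod_cast hk
      have hk' : (k' : ℝ) < 0 := by exact_mod_cast hk'
      simp only at h₁ h₂
      simp only [map_sub, map_zsmul, zsmul_eq_mul]
      nlinarith
  · intro h
    -- `U` holds the upper bounds imposed on `y` and `V` the lower ones; the combined inequalities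
    -- say that every lower bound is at most every upper bound.
    let U : Set ℝ := (fun c : C × ℤ => -(ev x c.1) / c.2) '' {c | c ∈ L ∧ 0 < c.2}
    let V : Set ℝ := (fun c : C × ℤ => -(ev x c.1) / c.2) '' {c | c ∈ L ∧ c.2 < 0}
    have hfin : ∀ p : C × ℤ → Prop, {c | c ∈ L ∧ p c}.Finite := fun p =>
      (List.finite_toSet L).subset fun c hc => hc.1
    obtain ⟨y, hV, hU⟩ := exists_between_finite (U := U) (V := V) ((hfin _).image _)
      ((hfin _).image _) (by
        rintro _ ⟨⟨b, k'⟩, ⟨hb, hk'⟩, rfl⟩ _ ⟨⟨a, k⟩, ⟨ha, hk⟩, rfl⟩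
        have := h (k • b - k' • a) (by
          refine List.mem_append_right _ (List.mem_map.2 ⟨((a, k), (b, k')), ?_, rfl⟩)
          simpa [ha, hb] using ⟨hk, hk'⟩)
        simp only [map_sub, map_zsmul, zsmul_eq_mul] at this
        have hk : (0 : ℝ) < k := by exact_mod_cast hk
        have hk' : (k' : ℝ) < 0 := by exact_mod_cast hk'
        simp only
        rw [div_le_iff_of_neg hk', div_mul_eq_mul_div, div_le_iff₀ hk]
        linarith)
    refine ⟨y, fun c hc => ?_⟩
    rcases lt_trichotomy c.2 0 with hk | hk | hk
    · have h₁ := hV _ ⟨c, ⟨hc, hk⟩, rfl⟩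
      have hk : (c.2 : ℝ) < 0 := by exact_mod_cast hk
      rw [div_le_iff_of_neg hk] at h₁
      linarith
    · have h₁ := h c.1 (List.mem_append_left _ (List.mem_map.2 ⟨c, by simp [hc, hk], rfl⟩))
      simpa [hk] using h₁
    · have h₁ := hU _ ⟨c, ⟨hc, hk⟩, rfl⟩
      have hk : (0 : ℝ) < c.2 := by exact_mod_cast hk
      rw [le_div_iff₀ hk] at h₁
      linarith

theorem exists_eliminate (N : ℕ) {X C : Type*} [AddCommGroup C] (ev : X → C →+ ℝ)
    (L : List (C × (Fin N → ℤ))) : ∃ L' : List C, ∀ x,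
      (∃ y : Fin N → ℝ, ∀ c ∈ L, ev x c.1 + ∑ j, (c.2 j : ℝ) * y j ≤ 0) ↔
        ∀ c ∈ L', ev x c ≤ 0 := by
  induction N with
  | zero =>
    refine ⟨L.map Prod.fst, fun x => ?_⟩
    simp
  | succ N ih =>
    -- While one variable is eliminated, the others count as parameters: this is why the
    -- coefficients range over an arbitrary group `C`.
    let ev' : X × (Fin N → ℝ) → C × (Fin N → ℤ) →+ ℝ := fun p =>
      { toFun := fun c => ev p.1 c.1 + ∑ j, (c.2 j : ℝ) * p.2 j
        map_zero' := by simp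
        map_add' := fun c c' => by
          simp only [Prod.fst_add, Prod.snd_add, map_add, Pi.add_apply, Int.cast_add, add_mul,
            Finset.sum_add_distrib]
          ring }
    obtain ⟨L₁, h₁⟩ := exists_eliminate_one ev' (L.map fun c => ((c.1, Fin.tail c.2), c.2 0))
    obtain ⟨L₂, h₂⟩ := ih L₁
    refine ⟨L₂, fun x => ?_⟩
    rw [← h₂ x]
    constructor
    · rintro ⟨y, hy⟩
      refine ⟨Fin.tail y, (h₁ (x, Fin.tail y)).1 ⟨y 0, ?_⟩⟩
      simp only [List.mem_map, forall_exists_index, and_imp, forall_apply_eq_imp_iff₂]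
      intro c hc
      have := hy c hc
      rw [Fin.sum_univ_succ] at this
      simp only [ev', AddMonoidHom.coe_mk, ZeroHom.coe_mk, Fin.tail]
      linarith
    · rintro ⟨y, hy⟩
      obtain ⟨y₀, hy₀⟩ := (h₁ (x, y)).2 hy
      refine ⟨Fin.cons y₀ y, fun c hc => ?_⟩
      have := hy₀ _ (List.mem_map_of_mem hc)
      simp only [ev', AddMonoidHom.coe_mk, ZeroHom.coe_mk, Fin.tail] at this
      rw [Fin.sum_univ_succ]
      simp only [Fin.cons_zero, Fin.cons_succ]
      linarith

/-- With weights along a fixed enumeration, membership is solvability of a linear system in `N` real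
unknowns, ready for elimination. -/
theorem mem_convexHull_range_iff {ι : Type*} {N : ℕ} (s : Fin N → ι → ℝ) (x : ι → ℝ) :
    x ∈ convexHull ℝ (Set.range s) ↔
      ∃ w : Fin N → ℝ, (∀ j, 0 ≤ w j) ∧ ∑ j, w j = 1 ∧ ∀ i, ∑ j, w j * s j i = x i := by
  constructor
  · intro hx
    have hconv : Convex ℝ {x : ι → ℝ | ∃ w : Fin N → ℝ, (∀ j, 0 ≤ w j) ∧ ∑ j, w j = 1 ∧
        ∀ i, ∑ j, w j * s j i = x i} := by
      rintro x ⟨w, hw, hw1, hx⟩ y ⟨w', hw', hw1', hy⟩ a b ha hb hab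
      refine ⟨fun j => a * w j + b * w' j, fun j => ?_, ?_, fun i => ?_⟩
      · have := mul_nonneg ha (hw j)
        have := mul_nonneg hb (hw' j)
        positivity
      · rw [Finset.sum_add_distrib, ← Finset.mul_sum, ← Finset.mul_sum, hw1, hw1']
        simpa using hab
      · simp only [add_mul, mul_assoc, Finset.sum_add_distrib, ← Finset.mul_sum, hx, hy,
          Pi.add_apply, Pi.smul_apply, smul_eq_mul]
    refine convexHull_min ?_ hconv hx
    rintro _ ⟨j, rfl⟩
    refine ⟨Pi.single j 1, fun j' => ?_, by simp, fun i => by simp [Pi.single_apply]⟩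
    by_cases h : j' = j <;> simp [h]
  · rintro ⟨w, hw, hw1, hx⟩
    refine mem_convexHull_of_exists_fintype w s hw hw1 (fun j => ⟨j, rfl⟩) ?_
    ext i
    simp [Finset.sum_apply, hx]

/-- The convex hull of finitely many integer points is defined by finitely many linear inequalities
with integer coefficients. -/
theorem exists_inequalities {ι : Type*} [Fintype ι] {S : Set (ι → ℤ)} (hS : S.Finite) :
    ∃ L : List ((ι → ℤ) × ℤ), ∀ (A : Subring ℝ) (x : ι → A),
      x ∈ convIn A S ↔ ∀ F ∈ L, ∑ i, (F.1 i : ℝ) * (x i : ℝ) ≤ F.2 := by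
  classical
  obtain ⟨N, s, -, rfl⟩ := hS.fin_param
  let ev : (ι → ℝ) → ((ι → ℤ) × ℤ) →+ ℝ := fun x =>
    { toFun := fun F => ∑ i, (F.1 i : ℝ) * x i - F.2
      map_zero' := by simp
      map_add' := fun F F' => by
        simp only [Prod.fst_add, Prod.snd_add, Pi.add_apply, Int.cast_add, add_mul,
          Finset.sum_add_distrib]
        ring }
  -- The four groups express `w j ≥ 0`, total weight `1` (as two inequalities), and the two halves
  -- of `x i = ∑ j, w j * s j i`. The weights are real, so the resulting list does not depend on
  -- `A`.
  obtain ⟨L, hL⟩ := exists_eliminate N ev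
    ((List.finRange N).map (fun j => ((0, 0), -Pi.single j 1)) ++
      [((0, 1), 1), ((0, -1), -1)] ++
      Finset.univ.toList.map (fun i => ((Pi.single i 1, 0), fun j => -s j i)) ++
      Finset.univ.toList.map (fun i => ((-Pi.single i 1, 0), fun j => s j i)))
  refine ⟨L, fun A x => ?_⟩
  have h := hL fun i => (x i : ℝ)
  simp only [ev, AddMonoidHom.coe_mk, ZeroHom.coe_mk, sub_nonpos] at h
  rw [← h, convIn, Set.mem_ofPred_eq, ← Set.range_comp, mem_convexHull_range_iff]
  refine exists_congr fun w => ?_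
  simp only [List.mem_append, List.mem_map, List.mem_finRange, true_and, List.mem_cons,
    List.not_mem_nil, or_false, Finset.mem_toList, Finset.mem_univ, or_imp, forall_and,
    forall_exists_index, forall_apply_eq_imp_iff, forall_eq]
  simp only [Pi.zero_apply, Int.cast_zero, zero_mul, Finset.sum_const_zero, Pi.neg_apply,
    Int.cast_neg, neg_mul, Finset.sum_neg_distrib, Pi.single_apply, Int.cast_ite, Int.cast_one,
    ite_mul, one_mul, Finset.sum_ite_eq', Finset.mem_univ, if_true, Pi.one_apply,
    Function.comp_apply, and_assoc, sub_zero, zero_add]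
  refine and_congr (forall_congr' fun j => by simp) ?_
  rw [← and_assoc, ← forall_and]
  have hc : ∀ i, ∑ j, (s j i : ℝ) * w j = ∑ j, w j * (s j i : ℝ) := fun i =>
    Finset.sum_congr rfl fun j _ => mul_comm _ _
  refine and_congr ⟨fun h => ?_, fun h => ?_⟩ (forall_congr' fun i => ?_)
  · constructor <;> linarith
  · linarith [h.1, h.2]
  · rw [hc]
    constructor
    · intro h
      constructor <;> linarith
    · intro h
      linarith [h.1, h.2]

/-! ## Affine hulls of finitely many points -/

section Affine

variable {R : Type*} [CommRing R] {R' : Subring R} {ι : Type*}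

theorem mem_affIn_of_fintype {κ : Type*} [Fintype κ] {S : Set (ι → R)} (r : κ → R)
    (s : κ → ι → R) (hr : ∀ q, r q ∈ R') (hs : ∀ q, s q ∈ S) (h1 : ∑ q, r q = 1) :
    (fun i => ∑ q, r q * s q i) ∈ affIn R' S := by
  let e := (Fintype.equivFin κ).symm
  refine ⟨_, fun j => r (e j), fun j => s (e j), fun j => hr _, fun j => hs _, ?_, ?_⟩
  · rw [← h1]
    exact e.sum_comp r
  · funext i
    exact (e.sum_comp fun q => r q * s q i).symm

/-- Points outside `P` are switched off by zero coefficients instead of being left out, so the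
number of unknowns is the same for all `P`. -/
theorem mem_affIn_image_iff {κ : Type*} [Fintype κ] {P : κ → Prop} [DecidablePred P]
    {s : κ → ι → R} {x : ι → R} : x ∈ affIn R' (s '' {q | P q}) ↔
      ∃ r : κ → R, (∀ q, r q ∈ R') ∧ ∑ q, (if P q then 1 else 0) * r q = 1 ∧
        ∀ i, ∑ q, (if P q then s q i else 0) * r q = x i := by
  classical
  constructor
  · rintro ⟨n, r, s', hr, hs', h1, rfl⟩
    choose q hq hs' using hs'
    have hsum : ∀ t : κ → R, ∑ y, (if P y then t y else 0) * ∑ j, (if q j = y then r j else 0) =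
        ∑ j, t (q j) * r j := by
      intro t
      simp only [Finset.mul_sum]
      rw [Finset.sum_comm]
      refine Finset.sum_congr rfl fun j _ => ?_
      rw [Finset.sum_eq_single (q j)]
      · have : P (q j) := hq j
        simp [this]
      · intro y _ hy
        simp [hy.symm]
      · simp
    -- A combination may use a point repeatedly; the weight of `y` collects all its occurrences.
    refine ⟨fun y => ∑ j, if q j = y then r j else 0, fun y => Subring.sum_mem _ fun j _ => ?_,
      ?_, fun i => ?_⟩
    · split_ifs
      exacts [hr j, R'.zero_mem]
    · rw [hsum fun _ => 1]
      simpa using h1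
    · rw [hsum fun y => s y i]
      exact Finset.sum_congr rfl fun j _ => by rw [hs', mul_comm]
  · rintro ⟨r, hr, h1, hx⟩
    have hsum : ∀ t : κ → R, ∑ y, (if P y then t y else 0) * r y =
        ∑ y : {y // P y}, r y * t y := by
      intro t
      rw [← Finset.sum_subtype (Finset.univ.filter P) (by simp) fun y => r y * t y,
        Finset.sum_filter]
      exact Finset.sum_congr rfl fun y _ => by split_ifs <;> simp [mul_comm]
    have := mem_affIn_of_fintype (R' := R') (S := s '' {q | P q}) (fun y : {y // P y} => r y)
      (fun y => s y) (fun y => hr _) (fun y => ⟨y, y.2, rfl⟩) (by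
        have := hsum fun _ => 1
        rw [h1] at this
        simpa using this.symm)
    convert this using 1
    funext i
    rw [← hx i, hsum fun y => s y i]

/-- An affine combination of affine combinations is again one: the weights multiply like matrices,
and rows of sum `1` are preserved. Finiteness of `T` supplies a common index set for the inner
weights. -/
theorem affIn_subset {S T : Set (ι → R)} (hT : T.Finite) (h : S ⊆ affIn R' T) :
    affIn R' S ⊆ affIn R' T := by
  obtain ⟨N, s, -, rfl⟩ := hT.fin_param
  have hmem : ∀ x : ι → R, x ∈ affIn R' (Set.range s) ↔
      ∃ r : Fin N → R, (∀ q, r q ∈ R') ∧ ∑ q, r q = 1 ∧ ∀ i, ∑ q, s q i * r q = x i := by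
    intro x
    have := mem_affIn_image_iff (R' := R') (P := fun _ => True) (s := s) (x := x)
    simpa using this
  rintro _ ⟨n, r, t, hr, ht, h1, rfl⟩
  choose w hw hw1 hwt using fun j => (hmem _).1 (h (ht j))
  refine (hmem _).2 ⟨fun q => ∑ j, r j * w j q,
    fun q => Subring.sum_mem _ fun j _ => R'.mul_mem (hr j) (hw j q), ?_, fun i => ?_⟩
  · rw [Finset.sum_comm]
    simp only [← Finset.mul_sum, hw1, mul_one, h1]
  · simp only [Finset.mul_sum]
    rw [Finset.sum_comm]
    refine Finset.sum_congr rfl fun j _ => ?_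
    rw [← hwt j i, Finset.mul_sum]
    exact Finset.sum_congr rfl fun q _ => by ring

end Affine

/-! ## Correctness of the relaxations -/

theorem subset_convIn {A : Subring ℝ} {ι : Type*} {S : Set (ι → ℤ)} {x : ι → ℤ} (hx : x ∈ S) :
    (fun i => ((x i : ℤ) : A)) ∈ convIn A S :=
  subset_convexHull ℝ _ ⟨x, hx, by simp⟩

theorem subset_affIn {R : Type*} [CommRing R] {R' : Subring R} {ι : Type*} {S : Set (ι → R)}
    {x : ι → R} (hx : x ∈ S) : x ∈ affIn R' S :=
  ⟨1, fun _ => 1, fun _ => x, fun _ => R'.one_mem, fun _ => hx, by simp, by simp⟩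

section Relaxations

variable {l m : ℕ} {A : Fin l → Subring ℝ} {k : Fin l → ℕ} {R : Fin m → Type*}
  [∀ j, CommRing (R j)] {R' : ∀ j, Subring (R j)} {I D : Type*}
  {ar : I → ℕ}

theorem exists_relaxationSolution {P : Template ar D} {Ψ : Formula ar} (hΨ : Ψ.Satisfiable P)
    (g : D → (∀ j : Fin l, Fin (k j) → ℤ) × (∀ j : Fin m, R j)) :
    ∃ f, RelaxationSolution P A k R' g Ψ f := by
  obtain ⟨x, hx⟩ := hΨ
  refine ⟨fun i => ofIntegral A k (g (x i)), fun j => ⟨fun i => subset_convIn ⟨x i, rfl⟩,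
    fun c hc => ?_⟩, fun j c hc => subset_affIn ⟨_, hx c hc, rfl⟩⟩
  exact subset_convIn (x := fun q : Fin (ar c.1) × Fin (k j) => (g (x (c.2 q.1))).1 j q.2)
    ⟨fun t => x (c.2 t), hx c hc, rfl⟩

/-- In each factor, `Λ` is a hull containing `g(P)`, hence contains the hull of `g(P)`, where the
solution lies; then `h` maps `Λ` into `Q`. -/
theorem RelaxationSolution.satisfiedBy {E : Type*} {φ : D → E} {Γ : PromiseTemplate ar φ}
    {g : D → (∀ j : Fin l, Fin (k j) → ℤ) × (∀ j : Fin m, R j)} {h : LPLEDomain A k R → E}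
    (hgh : SandwichesVia Γ (LPLE A k R') (fun d => ofIntegral A k (g d)) h) {Ψ : Formula ar}
    {f : Fin Ψ.n → LPLEDomain A k R} (hf : RelaxationSolution Γ.P A k R' g Ψ f) :
    Ψ.SatisfiedBy Γ.Q fun i => h (f i) := by
  obtain ⟨Λ, hΛ, hg, hh⟩ := hgh
  intro c hc
  refine hh c.1 _ ?_
  obtain ⟨U, ⟨U', hU', rfl⟩, V, ⟨V', hV', rfl⟩, hUV⟩ := hΛ c.1
  have hg := hg c.1
  rw [hUV] at hg ⊢
  refine ⟨fun j => ?_, fun j => ?_⟩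
  · obtain ⟨S, hS, hSU⟩ := hU' j
    have h₁ := (hf.1 j).2 c hc
    have h₂ : ∀ x ∈ Γ.P c.1, _ := fun x hx => (hg x hx).1 j
    rw [hSU] at h₂ ⊢
    refine convexHull_min ?_ (convex_convexHull ℝ _) h₁
    rintro _ ⟨_, ⟨x, hx, rfl⟩, rfl⟩
    have h₃ := h₂ x hx
    simpa [ofIntegral, convIn] using h₃
  · obtain ⟨S, hS, hSU⟩ := hV' j
    have h₁ := hf.2 j c hc
    have h₂ : ∀ x ∈ Γ.P c.1, _ := fun x hx => (hg x hx).2 j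
    rw [hSU] at h₂ ⊢
    refine affIn_subset hS ?_ h₁
    rintro _ ⟨x, hx, rfl⟩
    exact h₂ x hx

end Relaxations

/-! ## Programs reading a formula -/

theorem list_ofFn_prod {β : Type*} (n k : ℕ) (G : Fin n × Fin k → β) :
    List.ofFn (fun j => G (finProdFinEquiv.symm j)) =
      (List.finRange n).flatMap fun i => (List.finRange k).map fun b => G (i, b) := by
  rw [List.ofFn_mul, List.flatMap_def, List.ofFn_eq_map]
  congr 1
  refine List.map_congr_left fun i _ => ?_
  rw [List.ofFn_eq_map]
  refine List.map_congr_left fun b _ => ?_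
  congr 1
  rw [Equiv.symm_apply_eq]
  ext
  simp [finProdFinEquiv, mul_comm, add_comm]

/-- The enumeration of `n` variables, followed by `C` blocks of `N` variables. -/
def sumProdEquiv (n C N : ℕ) : Fin (n + C * N) ≃ Fin n ⊕ Fin C × Fin N :=
  finSumFinEquiv.symm.trans ((Equiv.refl _).sumCongr finProdFinEquiv.symm)

theorem list_ofFn_sumProd {β : Type*} (n C N : ℕ) (G : Fin n ⊕ Fin C × Fin N → β) :
    List.ofFn (fun j => G (sumProdEquiv n C N j)) = List.ofFn (fun i => G (.inl i)) ++
      (List.finRange C).flatMap fun i => (List.finRange N).map fun b => G (.inr (i, b)) := by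
  rw [List.ofFn_add, ← list_ofFn_prod C N fun q => G (.inr q)]
  congr 2
  · funext i
    exact congrArg G (by
      simp only [sumProdEquiv, Equiv.trans_apply]
      erw [finSumFinEquiv_symm_apply_castAdd]
      rfl)
  · funext i
    simp [sumProdEquiv]

/-- The variables of the `p`-th clause, if its relation symbol is `i`. -/
def Formula.tuple {I : Type*} {ar : I → ℕ} (Ψ : Formula ar) (p : Fin Ψ.clauses.length) {i : I}
    (h : (Ψ.clauses.get p).1 = i) (t : Fin (ar i)) : Fin Ψ.n :=
  (Ψ.clauses.get p).2 (Fin.cast (by rw [h]) t)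

namespace PolyComputes

variable {α : Type u} {o : α → Data → Data} {s : α → ℕ} {e f : α → Data}

/-- With `weaken` and `index`, this extends the environment of a program by a bound variable, as the
bodies of list constructions require. -/
theorem withIndex {N : α → ℕ} (hN : PolyComputes o s e fun a => .ofNat (N a)) :
    PolyComputes (fun z : Σ a, Fin (N a) => o z.1) (fun z => s z.1)
      (fun z => .cons (e z.1) (.ofNat z.2)) fun z => .cons (e z.1) (.ofNat z.2) := by
  refine refl ((((hN.size_input.add hN.size_output).add (.const 1)).pullback
    fun z : Σ a, Fin (N a) => z.1).mono fun z => ?_)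
  have := z.2.2
  simp only [Data.size, Data.size_ofNat]
  omega

theorem weaken {N : α → ℕ} (hN : PolyComputes o s e fun a => .ofNat (N a))
    (h : PolyComputes o s e f) :
    PolyComputes (fun z : Σ a, Fin (N a) => o z.1) (fun z => s z.1)
      (fun z => .cons (e z.1) (.ofNat z.2)) fun z => f z.1 :=
  (hN.withIndex.fst.congr (g := fun z => e z.1) fun _ => rfl).trans (h.pullback _)

theorem index {N : α → ℕ} (hN : PolyComputes o s e fun a => .ofNat (N a)) :
    PolyComputes (fun z : Σ a, Fin (N a) => o z.1) (fun z => s z.1)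
      (fun z => .cons (e z.1) (.ofNat z.2)) fun z => .ofNat z.2 :=
  hN.withIndex.snd

theorem ofFn_prod {n : α → ℕ} {k : ℕ} {G : ∀ a, Fin (n a) × Fin k → Data}
    (hn : PolyComputes o s e fun a => .ofNat (n a))
    (h : ∀ b, PolyComputes (fun z : Σ a, Fin (n a) => o z.1) (fun z => s z.1)
      (fun z => .cons (e z.1) (.ofNat z.2)) fun z => G z.1 (z.2, b)) :
    PolyComputes o s e fun a => .ofList (List.ofFn fun j => G a (finProdFinEquiv.symm j)) :=
  (flatMap (F := fun a i => (List.finRange k).map fun b => G a (i, b)) hn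
    (list_map (F := fun b (z : Σ a, Fin (n a)) => G z.1 (z.2, b)) (List.finRange k)
      hn.withIndex.size_input fun b _ => h b)).congr fun a => by rw [list_ofFn_prod]

theorem ofFn_sumProd {n C : α → ℕ} {N : ℕ} {G : ∀ a, Fin (n a) ⊕ Fin (C a) × Fin N → Data}
    (hn : PolyComputes o s e fun a => .ofNat (n a))
    (hC : PolyComputes o s e fun a => .ofNat (C a))
    (h : PolyComputes (fun z : Σ a, Fin (n a) => o z.1) (fun z => s z.1)
      (fun z => .cons (e z.1) (.ofNat z.2)) fun z => G z.1 (.inl z.2))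
    (h' : ∀ b, PolyComputes (fun z : Σ a, Fin (C a) => o z.1) (fun z => s z.1)
      (fun z => .cons (e z.1) (.ofNat z.2)) fun z => G z.1 (.inr (z.2, b))) :
    PolyComputes o s e fun a => .ofList (List.ofFn fun j => G a (sumProdEquiv _ _ _ j)) :=
  ((ofFn hn h).append (flatMap (F := fun a i => (List.finRange N).map fun b => G a (.inr (i, b))) hC
    (list_map (F := fun b (z : Σ a, Fin (C a)) => G z.1 (.inr (z.2, b))) (List.finRange N)
      hC.withIndex.size_input fun b _ => h' b))).congr fun a => by rw [list_ofFn_sumProd]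

/-- Unary multiplication by measuring a list with `n a * k` dummy entries. -/
theorem mul_const {n : α → ℕ} (k : ℕ) (hn : PolyComputes o s e fun a => .ofNat (n a)) :
    PolyComputes o s e fun a => .ofNat (n a * k) :=
  (ofFn_prod (k := k) (G := fun _ _ => .nil) hn fun _ => .nil hn.withIndex.size_input).length.congr
    fun a => by rw [List.length_ofFn]

section Formula

variable {I : Type*} [Encodable I] {ar : I → ℕ} {Ψ : α → Formula ar}

theorem numVars (h : PolyComputes o s e fun a => (Ψ a).enc) :
    PolyComputes o s e fun a => .ofNat (Ψ a).n :=
  h.fst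

theorem numClauses (h : PolyComputes o s e fun a => (Ψ a).enc) :
    PolyComputes o s e fun a => .ofNat (Ψ a).clauses.length :=
  (h.snd.length).congr fun a => by rw [List.length_map]

theorem clause (h : PolyComputes o s e fun a => (Ψ a).enc) :
    PolyComputes (fun z : Σ a, Fin (Ψ a).clauses.length => o z.1) (fun z => s z.1)
      (fun z => .cons (e z.1) (.ofNat z.2)) fun z =>
        .cons (.ofNat (Encodable.encode ((Ψ z.1).clauses.get z.2).1))
          (.ofList (List.ofFn fun t => .ofNat (((Ψ z.1).clauses.get z.2).2 t))) := by
  refine nth_ofFn (n := fun z : Σ a, Fin (Ψ a).clauses.length => (Ψ z.1).clauses.length)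
    (F := fun z p => .cons (.ofNat (Encodable.encode ((Ψ z.1).clauses.get p).1))
          (.ofList (List.ofFn fun t => .ofNat (((Ψ z.1).clauses.get p).2 t))))
    (i := fun z => z.2) ((weaken h.numClauses h.snd).congr fun z => ?_) (index h.numClauses)
  simp only [Formula.enc, Data.snd_cons, List.get_eq_getElem]
  rw [List.ofFn_getElem_eq_map (Ψ z.1).clauses fun c =>
    Data.cons (.ofNat (Encodable.encode c.1)) (.ofList (List.ofFn fun t => .ofNat (c.2 t)))]

/-- Once the relation symbol is fixed, positions in the clause are constants, and each has its own
program. -/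
theorem tuple (h : PolyComputes o s e fun a => (Ψ a).enc) (i : I) (t : Fin (ar i)) :
    PolyComputes
      (fun z : {z : Σ a, Fin (Ψ a).clauses.length // ((Ψ z.1).clauses.get z.2).1 = i} => o z.1.1)
      (fun z => s z.1.1) (fun z => .cons (e z.1.1) (.ofNat z.1.2))
      fun z => .ofNat ((Ψ z.1.1).tuple z.1.2 z.2 t) := by
  refine nth_const (F := fun z t => .ofNat ((Ψ z.1.1).tuple z.1.2 z.2 t)) t
    ((h.clause.pullback (Subtype.val (p := fun z : Σ a, Fin (Ψ a).clauses.length =>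
      ((Ψ z.1).clauses.get z.2).1 = i))).snd.congr fun z => ?_)
  have key : ∀ {n : ℕ} (c : Σ i, Fin (ar i) → Fin n) (hc : c.1 = i),
      List.ofFn (fun t => Data.ofNat (c.2 t)) =
        List.ofFn fun t : Fin (ar i) => Data.ofNat (c.2 (Fin.cast (by rw [hc]) t)) := by
    rintro n c rfl
    rfl
  exact congrArg Data.ofList (key ((Ψ z.1.1).clauses.get z.1.2) z.2)

theorem flatMap_clauses [Finite I] (h : PolyComputes o s e fun a => (Ψ a).enc)
    {F : ∀ a, Fin (Ψ a).clauses.length → List Data}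
    (hF : ∀ i, PolyComputes
      (fun z : {z : Σ a, Fin (Ψ a).clauses.length // ((Ψ z.1).clauses.get z.2).1 = i} => o z.1.1)
      (fun z => s z.1.1) (fun z => .cons (e z.1.1) (.ofNat z.1.2))
      fun z => .ofList (F z.1.1 z.1.2)) :
    PolyComputes o s e fun a =>
      .ofList ((List.finRange (Ψ a).clauses.length).flatMap (F a)) :=
  flatMap h.numClauses (cases_encode (c := fun z => ((Ψ z.1).clauses.get z.2).1) h.clause.fst hF)

end Formula

end PolyComputes

/-! ## The linear programs -/

namespace LPSystem

/-- The system with the given rows, its variables being enumerated by `v`. -/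
def ofRows {ι : Type*} {N : ℕ} (v : Fin N ≃ ι) (L : List ((ι → ℤ) × ℤ)) : LPSystem where
  rows := L.length
  vars := N
  M i j := (L.get i).1 (v j)
  b i := (L.get i).2

def encRow {ι : Type*} {N : ℕ} (v : Fin N ≃ ι) (F : (ι → ℤ) × ℤ) : Data :=
  .cons (.ofList (List.ofFn fun j => .ofInt (F.1 (v j)))) (.ofInt F.2)

theorem enc_ofRows {ι : Type*} {N : ℕ} (v : Fin N ≃ ι) (L : List ((ι → ℤ) × ℤ)) :
    (ofRows v L).enc = .cons (.ofNat N) (.ofList (L.map (encRow v))) := by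
  rw [← List.ofFn_getElem_eq_map]
  rfl

theorem isSolution_ofRows {ι : Type*} [Fintype ι] {N : ℕ} (v : Fin N ≃ ι)
    (L : List ((ι → ℤ) × ℤ)) {A : Subring ℝ} (x : Fin N → A) :
    (ofRows v L).IsSolution x ↔ ∀ F ∈ L, ∑ i, (F.1 i : ℝ) * (x (v.symm i) : ℝ) ≤ F.2 := by
  have hsum : ∀ F : (ι → ℤ) × ℤ, ∑ j, (F.1 (v j) : ℝ) * (x j : ℝ) =
      ∑ i, (F.1 i : ℝ) * (x (v.symm i) : ℝ) := fun F => by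
    rw [← v.sum_comp]
    simp
  rw [List.forall_mem_iff_getElem]
  simp only [← hsum]
  exact ⟨fun h i hi => h ⟨i, hi⟩, fun h i => h i i.2⟩

end LPSystem

/-- The inequality `F` for the tuple of variables `c`, as an inequality in all variables. -/
def tupleRow {n k a : ℕ} (c : Fin a → Fin n) (F : (Fin a × Fin k → ℤ) × ℤ) :
    (Fin n × Fin k → ℤ) × ℤ :=
  (fun q => ∑ t, if c t = q.1 then F.1 (t, q.2) else 0, F.2)

/-- A clause may repeat a variable, in which case the coefficients of all its positions add up. -/
theorem sum_tupleRow {n k a : ℕ} (c : Fin a → Fin n) (F : (Fin a × Fin k → ℤ) × ℤ)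
    (x : Fin n × Fin k → ℝ) : ∑ q, ((tupleRow c F).1 q : ℝ) * x q =
      ∑ q : Fin a × Fin k, (F.1 q : ℝ) * x (c q.1, q.2) := by
  simp only [tupleRow, Int.cast_sum, Finset.sum_mul, Fintype.sum_prod_type]
  rw [Finset.sum_comm, Finset.sum_comm (s := Finset.univ (α := Fin a))]
  refine Finset.sum_congr rfl fun b _ => ?_
  rw [Finset.sum_comm]
  simp

section LP

variable {I : Type*} {ar : I → ℕ} {k : ℕ}

/-- The rows of the Basic LP relaxation, given inequalities for the domain and the relations. -/
def lpRows (L₀ : List ((Fin 1 × Fin k → ℤ) × ℤ)) (L : ∀ i, List ((Fin (ar i) × Fin k → ℤ) × ℤ))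
    (Ψ : Formula ar) : List ((Fin Ψ.n × Fin k → ℤ) × ℤ) :=
  (List.finRange Ψ.n).flatMap (fun i => L₀.map (tupleRow fun _ => i)) ++
    (List.finRange Ψ.clauses.length).flatMap fun p =>
      (L (Ψ.clauses.get p).1).map (tupleRow (Ψ.clauses.get p).2)

def lpSystem (L₀ : List ((Fin 1 × Fin k → ℤ) × ℤ))
    (L : ∀ i, List ((Fin (ar i) × Fin k → ℤ) × ℤ)) (Ψ : Formula ar) : LPSystem :=
  .ofRows finProdFinEquiv.symm (lpRows L₀ L Ψ)

theorem PolyComputes.tupleRow {α : Type u} {o : α → Data → Data} {s : α → ℕ} {e : α → Data}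
    {n : α → ℕ} {a : ℕ} {c : ∀ x, Fin a → Fin (n x)}
    (hn : PolyComputes o s e fun x => .ofNat (n x))
    (hc : ∀ t, PolyComputes o s e fun x => .ofNat (c x t)) (F : (Fin a × Fin k → ℤ) × ℤ) :
    PolyComputes o s e fun x =>
      LPSystem.encRow finProdFinEquiv.symm (PromiseCSP.tupleRow (c x) F) := by
  -- No binary addition has to be programmed: the partial sum `z` is a constant, and the tests `c t
  -- = i` form a finite decision tree whose leaves are constants.
  have hcoef : ∀ (b : Fin k) (T : List (Fin a)) (z : ℤ),
      PolyComputes (fun z : Σ x, Fin (n x) => o z.1) (fun z => s z.1)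
        (fun z => .cons (e z.1) (.ofNat z.2)) fun x => .ofInt (z +
          (T.map fun t => if c x.1 t = x.2 then F.1 (t, b) else 0).sum) := by
    intro b T
    induction T with
    | nil => exact fun z => (const hn.withIndex.size_input (.ofInt z)).congr fun x => by simp
    | cons t T ih =>
      intro z
      have heq := ((weaken hn (hc t)).decides_eq hn.index).congr
        (Q := fun x => c x.1 t = x.2) fun x => Fin.ext_iff.symm
      refine (PolyComputes.ite heq (ih (z + F.1 (t, b))) (ih z)).congr fun x => ?_
      by_cases h : c x.1 t = x.2 <;> simp [h, add_assoc]
  refine (PolyComputes.ofFn_prod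
    (G := fun x q => .ofInt ((PromiseCSP.tupleRow (c x) F).1 q)) hn fun b => ?_).cons
      (g := fun _ => .ofInt F.2) (const hn.size_input (.ofInt F.2))
  refine (hcoef b (List.finRange a) 0).congr fun x => ?_
  rw [zero_add, ← List.ofFn_eq_map, List.sum_ofFn]
  rfl

theorem PolyComputes.lpSystem [Finite I] [Encodable I] {α : Type u} {o : α → Data → Data}
    {s : α → ℕ} {e : α → Data} {Ψ : α → Formula ar} (h : PolyComputes o s e fun a => (Ψ a).enc)
    (L₀ : List ((Fin 1 × Fin k → ℤ) × ℤ)) (L : ∀ i, List ((Fin (ar i) × Fin k → ℤ) × ℤ)) :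
    PolyComputes o s e fun a => (PromiseCSP.lpSystem L₀ L (Ψ a)).enc := by
  have h₁ : PolyComputes o s e fun a => .ofList ((List.finRange (Ψ a).n).flatMap fun i =>
      L₀.map fun F => LPSystem.encRow finProdFinEquiv.symm (PromiseCSP.tupleRow (fun _ => i) F)) :=
    flatMap h.numVars (list_map L₀ h.numVars.withIndex.size_input fun F _ =>
      tupleRow (n := fun z : Σ a, Fin (Ψ a).n => (Ψ z.1).n) (c := fun z _ => z.2)
        (weaken h.numVars h.numVars) (fun _ => h.numVars.index) F)
  have h₂ : PolyComputes o s e fun a =>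
      .ofList ((List.finRange (Ψ a).clauses.length).flatMap fun p =>
        (L ((Ψ a).clauses.get p).1).map fun F => LPSystem.encRow finProdFinEquiv.symm
          (PromiseCSP.tupleRow ((Ψ a).clauses.get p).2 F)) := by
    refine flatMap_clauses h fun i => ?_
    have hw := ((weaken h.numClauses h.numVars).pullback
      (Subtype.val (p := fun z : Σ a, Fin (Ψ a).clauses.length =>
        ((Ψ z.1).clauses.get z.2).1 = i)))
    refine (list_map (L i) hw.size_input fun F _ =>
      tupleRow (c := fun z : {z : Σ a, Fin (Ψ a).clauses.length //
        ((Ψ z.1).clauses.get z.2).1 = i} => (Ψ z.1.1).tuple z.1.2 z.2) hw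
          (h.tuple i) F).congr fun z => ?_
    obtain ⟨z, rfl⟩ := z
    rfl
  refine (h.numVars.mul_const k).cons ((h₁.append h₂).congr
    (g := fun a => .ofList ((lpRows L₀ L (Ψ a)).map (LPSystem.encRow finProdFinEquiv.symm)))
    fun a => ?_) |>.congr fun a => (LPSystem.enc_ofRows _ _).symm
  simp only [lpRows, List.map_append, List.map_flatMap, List.map_map]
  rfl

theorem forall_mem_lpRows {L₀ : List ((Fin 1 × Fin k → ℤ) × ℤ)}
    {L : ∀ i, List ((Fin (ar i) × Fin k → ℤ) × ℤ)} {Ψ : Formula ar}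
    {p : (Fin Ψ.n × Fin k → ℤ) × ℤ → Prop} : (∀ F ∈ lpRows L₀ L Ψ, p F) ↔
      (∀ i, ∀ F ∈ L₀, p (tupleRow (fun _ => i) F)) ∧
        ∀ c ∈ Ψ.clauses, ∀ F ∈ L c.1, p (tupleRow c.2 F) := by
  simp only [lpRows, List.mem_append, or_imp, forall_and, List.mem_flatMap, List.mem_finRange,
    true_and, forall_exists_index, List.mem_map, and_imp]
  refine and_congr ⟨fun h i F hF => h _ i F hF rfl, fun h _ i F hF hx => hx ▸ h i F hF⟩
    ⟨fun h c hc F hF => ?_, fun h _ q F hF hx => hx ▸ h _ (List.get_mem _ _) F hF⟩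
  obtain ⟨q, rfl⟩ := List.get_of_mem hc
  exact h _ q F hF rfl

/-- The Basic LP relaxation over an LP-solvable ring can be solved in polynomial time. -/
theorem LPSolvable.exists_basicLP [Finite I] [Encodable I] {D : Type*} [Finite D] {A : Subring ℝ}
    {ρ : BitRep A} (hA : LPSolvable A ρ) (P : Template ar D) (g : D → Fin k → ℤ) :
    ∃ y : Formula ar → Data,
      (∀ Ψ, ((¬ ∃ v, BasicLPSolution P A g Ψ v) ∧ y Ψ = .nil) ∨
        ∃ u : Fin Ψ.n → Fin k → ρ.Name, BasicLPSolution P A g Ψ (fun i b => (u i b).val) ∧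
          ∃ d, y Ψ = .cons .nil d ∧ ∀ (i : Fin Ψ.n) (b : Fin k),
            (Data.snd^[(b : ℕ) + k * i] d).fst = (u i b).enc) ∧
      PolyComputes (fun z : (Data → Data) × Formula ar => z.1) (fun z => z.2.enc.size)
        (fun z => z.2.enc) fun z => y z.2 := by
  obtain ⟨L₀, hL₀⟩ := exists_inequalities (Set.finite_range g)
  choose L hL using fun i => exists_inequalities (((P i).toFinite).image
    fun (x : Fin (ar i) → D) (q : Fin (ar i) × Fin k) => g (x q.1) q.2)
  -- The condition on single variables is treated as a clause of arity one.
  let L₁ : List ((Fin 1 × Fin k → ℤ) × ℤ) := L₀.map fun F => (fun q => F.1 q.2, F.2)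
  obtain ⟨y, hy, hcomp⟩ := hA.2.exists_output
  have hsol : ∀ (Ψ : Formula ar) (x : Fin (Ψ.n * k) → A),
      (lpSystem L₁ L Ψ).IsSolution x ↔
        BasicLPSolution P A g Ψ fun i b => x (finProdFinEquiv (i, b)) := by
    intro Ψ x
    refine (LPSystem.isSolution_ofRows _ _ x).trans (forall_mem_lpRows.trans ?_)
    simp only [sum_tupleRow, Equiv.symm_symm, BasicLPSolution, hL₀, hL, L₁,
      List.mem_map, forall_exists_index, and_imp, forall_apply_eq_imp_iff₂]
    simp only [Fintype.sum_prod_type, Finset.univ_unique, Finset.sum_singleton]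
    rfl
  refine ⟨fun Ψ => y (lpSystem L₁ L Ψ), fun Ψ => ?_,
    PolyComputes.solve hcomp (PolyComputes.lpSystem (.refl .self) L₁ L)⟩
  rcases hy (lpSystem L₁ L Ψ) with ⟨hno, hnil⟩ | ⟨w, hw, hw'⟩
  · refine Or.inl ⟨fun ⟨v, hv⟩ => hno ⟨fun j => v (finProdFinEquiv.symm j).1
      (finProdFinEquiv.symm j).2, (hsol Ψ _).2 ?_⟩, hnil⟩
    simpa using hv
  · refine Or.inr ⟨fun (i : Fin Ψ.n) (b : Fin k) => w (finProdFinEquiv (i, b)),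
      (hsol Ψ _).1 hw, _, hw', fun i b => ?_⟩
    -- By definition, `finProdFinEquiv (i, b)` has value `b + k * i`.
    exact Data.fst_iterate_snd_ofFn (fun j => (w j).enc) (finProdFinEquiv (i, b))

end LP

/-! ## The systems of linear equations -/

/-- Some name of a given element. -/
noncomputable def BitRep.name {R : Type*} (σ : BitRep R) (a : R) : σ.Name :=
  ⟨(σ.surj a).choose, a, (σ.surj a).choose_spec⟩

namespace LESystem

variable {R : Type*} (σ : BitRep R)

/-- The system with the given rows, its variables being enumerated by `v`. -/
noncomputable def ofRows {ι : Type*} {N : ℕ} (v : Fin N ≃ ι) (res : ι → Bool)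
    (L : List ((ι → R) × R)) : LESystem σ where
  rows := L.length
  vars := N
  restricted j := res (v j)
  M i j := σ.name ((L.get i).1 (v j))
  b i := σ.name (L.get i).2

noncomputable def encRow {ι : Type*} {N : ℕ} (v : Fin N ≃ ι) (F : (ι → R) × R) : Data :=
  .cons (.ofList (List.ofFn fun j => (σ.name (F.1 (v j))).enc)) (σ.name F.2).enc

theorem enc_ofRows {ι : Type*} {N : ℕ} (v : Fin N ≃ ι) (res : ι → Bool)
    (L : List ((ι → R) × R)) : (ofRows σ v res L).enc =
      .cons (.ofList (List.ofFn fun j => .ofBool (res (v j)))) (.ofList (L.map (encRow σ v))) := by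
  rw [← List.ofFn_getElem_eq_map]
  rfl

theorem isSolution_ofRows [CommRing R] (R' : Subring R) {ι : Type*} [Fintype ι] {N : ℕ}
    (v : Fin N ≃ ι) (res : ι → Bool) (L : List ((ι → R) × R)) (x : Fin N → R) :
    (ofRows σ v res L).IsSolution R' x ↔ (∀ F ∈ L, ∑ i, F.1 i * x (v.symm i) = F.2) ∧
      ∀ i, res i = true → x (v.symm i) ∈ R' := by
  have hsum : ∀ F : (ι → R) × R, ∑ j, F.1 (v j) * x j = ∑ i, F.1 i * x (v.symm i) := fun F => by
    rw [← v.sum_comp]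
    simp
  refine and_congr ?_ ⟨fun h i hi => h (v.symm i) (by simpa [ofRows] using hi),
    fun h j hj => congrArg x (v.symm_apply_apply j) ▸ h (v j) hj⟩
  rw [List.forall_mem_iff_getElem]
  simp only [← hsum]
  exact ⟨fun h i hi => h ⟨i, hi⟩, fun h i => h i i.2⟩

end LESystem

section LE

variable {I : Type*} {ar : I → ℕ} {R : Type*} [CommRing R] {N : ℕ}

/-- An equation in the main variables and the auxiliary variables of the `p`-th clause. -/
def leRow {n C : ℕ} (p : Fin C) (w : Fin n → R) (r : Fin N → R) (b : R) :
    (Fin n ⊕ Fin C × Fin N → R) × R :=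
  (Sum.elim w fun q => if q.1 = p then r q.2 else 0, b)

theorem sum_leRow {n C : ℕ} (p : Fin C) (w : Fin n → R) (r : Fin N → R) (b : R)
    (x : Fin n ⊕ Fin C × Fin N → R) : ∑ i, (leRow p w r b).1 i * x i =
      ∑ j, w j * x (.inl j) + ∑ q, r q * x (.inr (p, q)) := by
  simp only [leRow, Fintype.sum_sum_type, Sum.elim_inl, Sum.elim_inr, Fintype.sum_prod_type,
    ite_mul, zero_mul]
  rw [Finset.sum_comm]
  simp

/-- The equations of the `p`-th clause, which has the variables `c`: the weights of the auxiliary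
variables are `r` in the normalisation and `s t` in the `t`-th coordinate. -/
def leBlock {n C a : ℕ} (p : Fin C) (c : Fin a → Fin n) (r : Fin N → R) (s : Fin a → Fin N → R) :
    List ((Fin n ⊕ Fin C × Fin N → R) × R) :=
  leRow p (fun _ => 0) r 1 ::
    (List.finRange a).map fun t => leRow p (fun j => if c t = j then -1 else 0) (s t) 0

theorem forall_mem_leBlock {n C a : ℕ} (p : Fin C) (c : Fin a → Fin n) (r : Fin N → R)
    (s : Fin a → Fin N → R) (x : Fin n ⊕ Fin C × Fin N → R) :
    (∀ F ∈ leBlock p c r s, ∑ i, F.1 i * x i = F.2) ↔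
      ∑ q, r q * x (.inr (p, q)) = 1 ∧
        ∀ t, ∑ q, s t q * x (.inr (p, q)) = x (.inl (c t)) := by
  simp only [leBlock, List.forall_mem_cons, List.mem_map, List.mem_finRange, true_and,
    forall_exists_index, forall_apply_eq_imp_iff, sum_leRow]
  refine and_congr (by simp [leRow]) (forall_congr' fun t => ?_)
  simp only [ite_mul, neg_mul, one_mul, zero_mul, Finset.sum_ite_eq, Finset.mem_univ, if_true,
    leRow]
  rw [neg_add_eq_zero, eq_comm]

def leRows (r : I → Fin N → R) (s : ∀ i, Fin (ar i) → Fin N → R) (Ψ : Formula ar) :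
    List ((Fin Ψ.n ⊕ Fin Ψ.clauses.length × Fin N → R) × R) :=
  (List.finRange Ψ.clauses.length).flatMap fun p =>
    leBlock p (Ψ.clauses.get p).2 (r (Ψ.clauses.get p).1) (s (Ψ.clauses.get p).1)

/-- The affine relaxation, with a block of `N` auxiliary variables for every clause. -/
noncomputable def leSystem (σ : BitRep R) (r : I → Fin N → R) (s : ∀ i, Fin (ar i) → Fin N → R)
    (Ψ : Formula ar) : LESystem σ :=
  .ofRows σ (sumProdEquiv _ _ _) Sum.isRight (leRows r s Ψ)

theorem PolyComputes.leRow {α : Type u} {o : α → Data → Data} {sz : α → ℕ} {e : α → Data}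
    (σ : BitRep R) {n C : α → ℕ} {p : ∀ x, Fin (C x)} {w : ∀ x, Fin (n x) → R}
    (hn : PolyComputes o sz e fun x => .ofNat (n x))
    (hC : PolyComputes o sz e fun x => .ofNat (C x))
    (hp : PolyComputes o sz e fun x => .ofNat (p x))
    (hw : PolyComputes (fun z : Σ x, Fin (n x) => o z.1) (fun z => sz z.1)
      (fun z => .cons (e z.1) (.ofNat z.2)) fun z => (σ.name (w z.1 z.2)).enc)
    (r : Fin N → R) (b : R) : PolyComputes o sz e fun x =>
      LESystem.encRow σ (sumProdEquiv _ _ _) (PromiseCSP.leRow (p x) (w x) r b) := by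
  refine (PolyComputes.ofFn_sumProd
    (G := fun x q => (σ.name ((PromiseCSP.leRow (p x) (w x) r b).1 q)).enc) hn hC hw
      fun q => ?_).cons (g := fun _ => (σ.name b).enc) (const hn.size_input (σ.name b).enc)
  have hpq := (hC.index.decides_eq (weaken hC hp)).congr
    (Q := fun z => z.2 = p z.1) fun z => Fin.ext_iff.symm
  have hsz := hC.withIndex.size_input
  refine (PolyComputes.ite hpq (const hsz (σ.name (r q)).enc)
    (const hsz (σ.name (0 : R)).enc)).congr fun z => ?_
  simp only [PromiseCSP.leRow, Sum.elim_inr]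
  split_ifs <;> rfl

/-- All coefficients are among `0`, `1`, `-1` and the finitely many values of `r` and `s`. Their
chosen names are constants of the program, which only has to compare indices and does no arithmetic
in `R`. -/
theorem PolyComputes.leBlock {α : Type u} {o : α → Data → Data} {sz : α → ℕ} {e : α → Data}
    (σ : BitRep R) {n C : α → ℕ} {a : ℕ} {p : ∀ x, Fin (C x)} {c : ∀ x, Fin a → Fin (n x)}
    (hn : PolyComputes o sz e fun x => .ofNat (n x))
    (hC : PolyComputes o sz e fun x => .ofNat (C x))
    (hp : PolyComputes o sz e fun x => .ofNat (p x))
    (hc : ∀ t, PolyComputes o sz e fun x => .ofNat (c x t))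
    (r : Fin N → R) (s : Fin a → Fin N → R) : PolyComputes o sz e fun x =>
      .ofList ((PromiseCSP.leBlock (p x) (c x) r s).map
        (LESystem.encRow σ (sumProdEquiv _ _ _))) := by
  have hsz := hn.withIndex.size_input
  have h₁ := leRow σ (w := fun x (_ : Fin (n x)) => 0) hn hC hp
    (const hsz (σ.name (0 : R)).enc) r 1
  have h₂ := fun t => leRow σ (w := fun x (j : Fin (n x)) => if c x t = j then -1 else 0) hn hC hp
    ((PolyComputes.ite (((weaken hn (hc t)).decides_eq hn.index).congr
      (Q := fun z => c z.1 t = z.2) fun z => Fin.ext_iff.symm) (const hsz (σ.name (-1 : R)).enc)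
      (const hsz (σ.name (0 : R)).enc)).congr fun z => by split_ifs <;> rfl) (s t) 0
  refine (h₁.cons (list_map (List.finRange a) hn.size_input fun t _ => h₂ t)).congr fun x => ?_
  simp only [PromiseCSP.leBlock, List.map_cons, List.map_map, Data.ofList]
  rfl

theorem PolyComputes.leSystem [Finite I] [Encodable I] {α : Type u} {o : α → Data → Data}
    {sz : α → ℕ} {e : α → Data} {Ψ : α → Formula ar}
    (h : PolyComputes o sz e fun a => (Ψ a).enc) (σ : BitRep R) (r : I → Fin N → R)
    (s : ∀ i, Fin (ar i) → Fin N → R) :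
    PolyComputes o sz e fun a => (PromiseCSP.leSystem σ r s (Ψ a)).enc := by
  have h₁ : PolyComputes o sz e fun a => .ofList (List.ofFn fun j =>
      .ofBool (Sum.isRight (sumProdEquiv (Ψ a).n (Ψ a).clauses.length N j))) :=
    ofFn_sumProd (G := fun a q => .ofBool (Sum.isRight q)) h.numVars h.numClauses
      (const h.numVars.withIndex.size_input .nil)
      fun _ => const h.numClauses.withIndex.size_input (.cons .nil .nil)
  have h₂ : PolyComputes o sz e fun a =>
      .ofList ((List.finRange (Ψ a).clauses.length).flatMap fun p =>
        (PromiseCSP.leBlock p ((Ψ a).clauses.get p).2 (r ((Ψ a).clauses.get p).1)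
          (s ((Ψ a).clauses.get p).1)).map (LESystem.encRow σ (sumProdEquiv _ _ _))) := by
    refine flatMap_clauses h fun i => ?_
    let φ := Subtype.val (p := fun z : Σ a, Fin (Ψ a).clauses.length =>
      ((Ψ z.1).clauses.get z.2).1 = i)
    refine (leBlock σ (C := fun z => (Ψ z.1.1).clauses.length) (p := fun z => z.1.2)
      (c := fun z : {z : Σ a, Fin (Ψ a).clauses.length //
        ((Ψ z.1).clauses.get z.2).1 = i} => (Ψ z.1.1).tuple z.1.2 z.2)
      ((weaken h.numClauses h.numVars).pullback φ)
      ((weaken h.numClauses h.numClauses).pullback φ)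
      (h.numClauses.index.pullback φ) (h.tuple i) (r i) (s i)).congr fun z => ?_
    obtain ⟨z, rfl⟩ := z
    rfl
  refine (h₁.cons (h₂.congr (g := fun a => .ofList ((leRows r s (Ψ a)).map
    (LESystem.encRow σ (sumProdEquiv _ _ _)))) fun a => ?_)).congr
      fun a => (LESystem.enc_ofRows _ _ _ _).symm
  simp only [leRows, List.map_flatMap]

theorem forall_mem_leRows {r : I → Fin N → R} {s : ∀ i, Fin (ar i) → Fin N → R} {Ψ : Formula ar}
    (x : Fin Ψ.n ⊕ Fin Ψ.clauses.length × Fin N → R) :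
    (∀ F ∈ leRows r s Ψ, ∑ i, F.1 i * x i = F.2) ↔
      ∀ p, ∑ q, r (Ψ.clauses.get p).1 q * x (.inr (p, q)) = 1 ∧
        ∀ t, ∑ q, s (Ψ.clauses.get p).1 t q * x (.inr (p, q)) =
          x (.inl ((Ψ.clauses.get p).2 t)) := by
  simp only [← forall_mem_leBlock, leRows, List.mem_flatMap, List.mem_finRange, true_and,
    forall_exists_index]
  exact forall_comm

/-- Enumerate the points of all relations in one list and let `P i` mark those belonging to `i`.
Every clause then has the same number of auxiliary variables. -/
theorem exists_uniform_enumeration [Finite I] (S : ∀ i, Set (Fin (ar i) → R))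
    (hS : ∀ i, (S i).Finite) : ∃ (N : ℕ) (P : I → Fin N → Prop)
      (s : ∀ i, Fin N → Fin (ar i) → R), ∀ i, S i = s i '' {q | P i q} := by
  classical
  have := fun i => (hS i).to_subtype
  let v := (Finite.equivFin (Σ i, S i)).symm
  -- The value `0` at points of other symbols is arbitrary, since `P i` excludes them.
  let pt : ∀ i, (Σ i, S i) → Fin (ar i) → R := fun i z => if h : z.1 = i then h ▸ z.2.1 else 0
  refine ⟨_, fun i q => (v q).1 = i, fun i q => pt i (v q),
    fun i => Set.ext fun x => ⟨fun hx => ⟨v.symm ⟨i, x, hx⟩, ?_, ?_⟩, ?_⟩⟩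
  · simp
  · simp only [Equiv.apply_symm_apply]
    simp [pt]
  · rintro ⟨q, rfl, rfl⟩
    simp [pt]

/-- The affine relaxation over an LE-solvable pair can be solved in polynomial time. -/
theorem LESolvablePair.exists_affine [Finite I] [Encodable I] {D : Type*} [Finite D]
    {R' : Subring R} {σ : BitRep R} (hR : LESolvablePair R' σ) (P : Template ar D) (g : D → R) :
    ∃ y : Formula ar → Data,
      (∀ Ψ, ((¬ ∃ w, AffineSolution P R' g Ψ w) ∧ y Ψ = .nil) ∨
        ∃ u : Fin Ψ.n → σ.Name, AffineSolution P R' g Ψ (fun i => (u i).val) ∧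
          ∃ d, y Ψ = .cons .nil d ∧ ∀ i : Fin Ψ.n, (Data.snd^[i] d).fst = (u i).enc) ∧
      PolyComputes (fun z : (Data → Data) × Formula ar => z.1) (fun z => z.2.enc.size)
        (fun z => z.2.enc) fun z => y z.2 := by
  classical
  obtain ⟨N, Q, s, hs⟩ := exists_uniform_enumeration
    (fun i => (fun (x : Fin (ar i) → D) (t : Fin (ar i)) => g (x t)) '' P i)
    fun i => (P i).toFinite.image _
  let r : I → Fin N → R := fun i q => if Q i q then 1 else 0
  let s' : ∀ i, Fin (ar i) → Fin N → R := fun i t q => if Q i q then s i q t else 0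
  obtain ⟨y, hy, hcomp⟩ := hR.exists_output
  have haff : ∀ (Ψ : Formula ar) (w : Fin Ψ.n → R), AffineSolution P R' g Ψ w ↔
      ∀ p : Fin Ψ.clauses.length, ∃ z : Fin N → R, (∀ q, z q ∈ R') ∧
        ∑ q, r (Ψ.clauses.get p).1 q * z q = 1 ∧
          ∀ t, ∑ q, s' (Ψ.clauses.get p).1 t q * z q = w ((Ψ.clauses.get p).2 t) := by
    intro Ψ w
    simp only [AffineSolution, hs, mem_affIn_image_iff]
    exact ⟨fun h p => h _ (List.get_mem _ _), fun h c hc => by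
      obtain ⟨p, rfl⟩ := List.get_of_mem hc
      exact h p⟩
  have hsol : ∀ (Ψ : Formula ar) (x : Fin (Ψ.n + Ψ.clauses.length * N) → R),
      (leSystem σ r s' Ψ).IsSolution R' x ↔
        (∀ p, ∑ q, r (Ψ.clauses.get p).1 q * x ((sumProdEquiv _ _ _).symm (.inr (p, q))) = 1 ∧
          ∀ t, ∑ q, s' (Ψ.clauses.get p).1 t q * x ((sumProdEquiv _ _ _).symm (.inr (p, q))) =
            x ((sumProdEquiv _ _ _).symm (.inl ((Ψ.clauses.get p).2 t)))) ∧
        ∀ p q, x ((sumProdEquiv _ _ _).symm (.inr (p, q))) ∈ R' := by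
    intro Ψ x
    refine (LESystem.isSolution_ofRows σ R' _ _ _ x).trans
      (and_congr (forall_mem_leRows fun i => x ((sumProdEquiv _ _ _).symm i)) ?_)
    simp
  refine ⟨fun Ψ => y (leSystem σ r s' Ψ), fun Ψ => ?_,
    PolyComputes.solve hcomp (PolyComputes.leSystem (.refl .self) σ r s')⟩
  rcases hy (leSystem σ r s' Ψ) with ⟨hno, hnil⟩ | ⟨w, hw, hw'⟩
  · refine Or.inl ⟨fun ⟨v, hv⟩ => hno ?_, hnil⟩
    choose z hz h₁ h₂ using (haff Ψ v).1 hv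
    refine ⟨fun j => Sum.elim v (fun q => z q.1 q.2) (sumProdEquiv _ _ _ j), (hsol Ψ _).2 ?_⟩
    simpa using ⟨fun p => ⟨h₁ p, h₂ p⟩, hz⟩
  · obtain ⟨h₁, h₂⟩ := (hsol Ψ _).1 hw
    refine Or.inr ⟨fun i => w ((sumProdEquiv _ _ _).symm (.inl i)),
      (haff Ψ _).2 fun p => ⟨_, h₂ p, h₁ p⟩, _, hw', fun i => ?_⟩
    -- The main variables are enumerated before the auxiliary ones, so the `i`-th entry of the
    -- solution is the value of `x_i`.
    exact Data.fst_iterate_snd_ofFn (fun j => (w j).enc) ((sumProdEquiv _ _ _).symm (.inl i))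

end LE

/-! ## The combined algorithm -/

theorem PolyBounded.of_finite_range {α : Type u} {β : Type v} [Finite β] {s : α → ℕ} (F : β → ℕ)
    (c : α → β) : PolyBounded s fun a => F (c a) := by
  obtain ⟨B, hB⟩ := (Set.finite_range F).bddAbove
  exact (PolyBounded.const B).mono fun a => hB ⟨c a, rfl⟩

section Algorithm

variable {l m : ℕ} {A : Fin l → Subring ℝ} {k : Fin l → ℕ} {ρ : ∀ j, BitRep (A j)}
  {R : Fin m → Type*} {σ : ∀ j, BitRep (R j)} {E : Type*} [Finite E] [Encodable E]

/-- Reading off the names of the coordinates of the `i`-th point from lists of solutions and asking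
the oracle for its value, for every `i`. -/
theorem PolyComputes.query_all {h : LPLEDomain A k R → E} {α : Type u} {o : α → Data → Data}
    {s : α → ℕ} {e : α → Data} {n : α → ℕ} (ho : ∀ a, o a ∈ OraclesFor ρ σ h)
    (hn : PolyComputes o s e fun a => .ofNat (n a))
    {d : Fin l → α → Data} (hd : ∀ j, PolyComputes o s e (d j))
    {d' : Fin m → α → Data} (hd' : ∀ j, PolyComputes o s e (d' j))
    {u : ∀ a, Fin (n a) → ∀ j, Fin (k j) → (ρ j).Name}
    (hu : ∀ a (i : Fin (n a)) j (b : Fin (k j)),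
      (Data.snd^[(b : ℕ) + k j * i] (d j a)).fst = (u a i j b).enc)
    {w : ∀ a, Fin (n a) → ∀ j, (σ j).Name}
    (hw : ∀ a (i : Fin (n a)) j, (Data.snd^[i] (d' j a)).fst = (w a i j).enc) :
    PolyComputes o s e fun a => .ofList (List.ofFn fun i => .ofNat (Encodable.encode
      (h (fun j b => (u a i j b).val, fun j => (w a i j).val)))) := by
  have hsz := hn.withIndex.size_input
  have hq : PolyComputes (fun z : Σ a, Fin (n a) => o z.1) (fun z => s z.1)
      (fun z => .cons (e z.1) (.ofNat z.2)) fun z =>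
        .cons (.ofList (List.ofFn fun j => .ofList (List.ofFn fun b => (u z.1 z.2 j b).enc)))
          (.ofList (List.ofFn fun j => (w z.1 z.2 j).enc)) := by
    refine (list_ofFn hsz fun j => list_ofFn hsz fun b => ?_).cons (list_ofFn hsz fun j => ?_)
    · refine ((iterate_snd_mul (k j) (weaken hn (hd j)) hn.index).iterate_snd b).fst.congr
        fun z => ?_
      rw [← Function.iterate_add_apply, hu]
    · exact (iterate_snd_mul 1 (weaken hn (hd' j)) hn.index).fst.congr fun z => by
        rw [one_mul, hw]
  refine ofFn hn ((hq.query ?_).congr fun z => ho z.1 _ _)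
  -- The answers encode elements of the finite set `E`, so their sizes are bounded by a constant.
  simp only [fun z : Σ a, Fin (n a) => ho z.1 (u z.1 z.2) (w z.1 z.2)]
  exact .of_finite_range (fun x : E => (Data.ofNat (Encodable.encode x)).size) _

end Algorithm

/-- Solve all relaxations and, if this is possible, apply `h` to the points found. -/
theorem polyTimeWith_relaxations {l m : ℕ}
    {A : Fin l → Subring ℝ} {k : Fin l → ℕ} {ρ : ∀ j, BitRep (A j)}
    (hA : ∀ j, LPSolvable (A j) (ρ j))
    {R : Fin m → Type*} [∀ j, CommRing (R j)] {R' : ∀ j, Subring (R j)}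
    {σ : ∀ j, BitRep (R j)}
    (hR : ∀ j, LESolvablePair (R' j) (σ j))
    {I D E : Type*} [Finite I] [Encodable I] [Finite D] [Finite E] [Encodable E]
    {ar : I → ℕ} (P : Template ar D)
    (g : D → (∀ j : Fin l, Fin (k j) → ℤ) × (∀ j : Fin m, R j))
    (h : LPLEDomain A k R → E) :
    PolyTimeWith (OraclesFor ρ σ h)
      (Formula.enc (ar := ar))
      (fun Ψ y =>
        ((¬ ∃ f, RelaxationSolution P A k R' g Ψ f) ∧ y = Data.ofOption none) ∨
        ∃ f, RelaxationSolution P A k R' g Ψ f ∧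
          y = Data.ofOption (some (Data.ofList (List.ofFn fun i =>
            Data.ofNat (Encodable.encode (h (f i))))))) := by
  classical
  choose y hy hyc using fun j => (hA j).exists_basicLP P fun d => (g d).1 j
  choose z hz hzc using fun j => (hR j).exists_affine P fun d => (g d).2 j
  let 𝒪 := OraclesFor ρ σ h
  let good : Formula ar → Prop := fun Ψ => (∀ j, y j Ψ ≠ .nil) ∧ ∀ j, z j Ψ ≠ .nil
  have hu : ∀ Ψ : {Ψ // good Ψ}, ∀ j, _ := fun Ψ j => (hy j Ψ).resolve_left fun h => Ψ.2.1 j h.2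
  have hw : ∀ Ψ : {Ψ // good Ψ}, ∀ j, _ := fun Ψ j => (hz j Ψ).resolve_left fun h => Ψ.2.2 j h.2
  choose u hu d hd hud using hu
  choose w hw d' hd' hwd using hw
  let f : ∀ Ψ : {Ψ // good Ψ}, Fin Ψ.1.n → LPLEDomain A k R := fun Ψ i =>
    (fun j b => (u Ψ j i b).val, fun j => (w Ψ j i).val)
  -- The solvers' outputs depend on `Ψ` alone, so the points `f` and the answer are the same for all
  -- admissible oracles.
  let out : Formula ar → Data := fun Ψ => if hΨ : good Ψ then
    .cons .nil (.ofList (List.ofFn fun i => .ofNat (Encodable.encode (h (f ⟨Ψ, hΨ⟩ i))))) else .nil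
  have out_pos : ∀ Ψ (hΨ : good Ψ), out Ψ = .cons .nil (.ofList (List.ofFn fun i =>
      .ofNat (Encodable.encode (h (f ⟨Ψ, hΨ⟩ i))))) := fun Ψ hΨ => dif_pos hΨ
  have out_neg : ∀ Ψ, ¬ good Ψ → out Ψ = .nil := fun Ψ hΨ => dif_neg hΨ
  have hyc' : ∀ j, PolyComputes (fun a : 𝒪 × Formula ar => a.1) (fun a => a.2.enc.size)
      (fun a => a.2.enc) fun a => y j a.2 := fun j =>
    (hyc j).pullback fun a : 𝒪 × Formula ar => ((a.1 : Data → Data), a.2)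
  have hzc' : ∀ j, PolyComputes (fun a : 𝒪 × Formula ar => a.1) (fun a => a.2.enc.size)
      (fun a => a.2.enc) fun a => z j a.2 := fun j =>
    (hzc j).pullback fun a : 𝒪 × Formula ar => ((a.1 : Data → Data), a.2)
  refine PolyComputes.polyTimeWith (f := fun a => out a.2) ?_ fun a => ?_
  · refine PolyComputes.cases_prop (P := fun a => good a.2)
      ((PolyDecides.forall_fin .self fun j => .of_computes (hyc' j)).and
        (.forall_fin .self fun j => .of_computes (hzc' j))) ?_
      ((PolyComputes.nil .self).congr fun a => (out_neg _ a.2).symm)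
    let φ : {a : 𝒪 × Formula ar // good a.2} → {Ψ // good Ψ} := fun a => ⟨a.1.2, a.2⟩
    have hq := PolyComputes.query_all (o := fun a : {a : 𝒪 × Formula ar // good a.2} => a.1.1)
      (s := fun a => a.1.2.enc.size) (e := fun a => a.1.2.enc) (n := fun a => a.1.2.n)
      (h := h) (ρ := ρ) (σ := σ) (fun a => a.1.1.2)
      (PolyComputes.numVars (Ψ := fun a : {a : 𝒪 × Formula ar // good a.2} => a.1.2) (.refl .self))
      (d := fun j a => d (φ a) j) (fun j => (((hyc' j).pullback Subtype.val).snd).congr fun a =>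
        congrArg Data.snd (hd (φ a) j))
      (d' := fun j a => d' (φ a) j) (fun j => (((hzc' j).pullback Subtype.val).snd).congr fun a =>
        congrArg Data.snd (hd' (φ a) j))
      (u := fun a i j b => u (φ a) j i b) (fun a i j b => hud (φ a) j i b)
      (w := fun a i j => w (φ a) j i) (fun a i j => hwd (φ a) j i)
    exact ((PolyComputes.nil .self).cons hq).congr fun a => (out_pos _ a.2).symm
  · by_cases ha : good a.2
    · refine Or.inr ⟨f ⟨a.2, ha⟩, ⟨fun j => hu ⟨a.2, ha⟩ j, fun j => hw ⟨a.2, ha⟩ j⟩, out_pos _ ha⟩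
    · refine Or.inl ⟨fun ⟨f, hf⟩ => ha ⟨fun j hj => ?_, fun j hj => ?_⟩, out_neg _ ha⟩
      · rcases hy j a.2 with h | ⟨_, _, _, h, _⟩
        · exact h.1 ⟨_, hf.1 j⟩
        · rw [hj] at h
          cases h
      · rcases hz j a.2 with h | ⟨_, _, _, h, _⟩
        · exact h.1 ⟨_, hf.2 j⟩
        · rw [hj] at h
          cases h

/-! ### From search to decision, and the main theorem -/

theorem PolyTimeWith.mono {𝒪 : Set (Data → Data)} {X : Type*} {enc : X → Data}
    {spec spec' : X → Data → Prop} (h : PolyTimeWith 𝒪 enc spec)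
    (hs : ∀ x y, spec x y → spec' x y) : PolyTimeWith 𝒪 enc spec' := by
  obtain ⟨p, T, h⟩ := h
  refine ⟨p, T, fun O hO x => ?_⟩
  obtain ⟨y, t, ht, hT, hy⟩ := h O hO x
  exact ⟨y, t, ht, hT, hs x y hy⟩

/-- A polynomial-time algorithm whose output separates the instances also decides the problem. -/
theorem PolyTimeWith.mem_pWithOracle {𝒪 : Set (Data → Data)} {X : Type*} {enc : X → Data}
    {spec : X → Data → Prop} (h : PolyTimeWith 𝒪 enc spec) (Q : PromiseProblem)
    (hyes : ∀ x ∈ Q.yes, ∃ a, x = enc a ∧ ∀ y, spec a y → y ≠ .nil)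
    (hno : ∀ x ∈ Q.no, ∃ a, x = enc a ∧ ∀ y, spec a y → y = .nil) : Q ∈ PWithOracle 𝒪 := by
  obtain ⟨p, T, h⟩ := h
  -- The added linear term generously covers the branching and the writing of the one-bit answer.
  refine ⟨.ite p (.pair .nil .nil) .nil, T + 10 * Polynomial.X + 10, fun O hO =>
    ⟨fun x hx => ?_, fun x hx => ?_⟩⟩
  · obtain ⟨a, rfl, ha⟩ := hyes x hx
    obtain ⟨y, t, ht, hT, hy⟩ := h O hO a
    rcases y with _ | ⟨b, c⟩
    · exact absurd rfl (ha _ hy)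
    · refine ⟨_, ?_, .ite_true ht (.pair (.nil _) (.nil _))⟩
      simp only [Data.size, Polynomial.eval_add, Polynomial.eval_mul, Polynomial.eval_X,
        Polynomial.eval_ofNat]
      omega
  · obtain ⟨a, rfl, ha⟩ := hno x hx
    obtain ⟨y, t, ht, hT, hy⟩ := h O hO a
    obtain rfl := ha _ hy
    refine ⟨_, ?_, .ite_false ht (.nil _)⟩
    simp only [Polynomial.eval_add, Polynomial.eval_mul, Polynomial.eval_X, Polynomial.eval_ofNat]
    omega

end PromiseCSP

theorem mainTheorem5 {l m : ℕ}
    (A : Fin l → Subring ℝ) (k : Fin l → ℕ) (ρ : ∀ j, BitRep (A j))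
    (hA : ∀ j, LPSolvable (A j) (ρ j))
    (R : Fin m → Type*) [∀ j, CommRing (R j)] (R' : ∀ j, Subring (R j))
    (σ : ∀ j, BitRep (R j))
    (hR : ∀ j, LESolvablePair (R' j) (σ j))
    {I D E : Type*} [Finite I] [Encodable I] [Finite D] [Finite E] [Encodable E]
    {ar : I → ℕ} {φ : D → E} (Γ : PromiseTemplate ar φ)
    (g : D → (∀ j : Fin l, Fin (k j) → ℤ) × (∀ j : Fin m, R j))
    (h : LPLEDomain A k R → E)
    (hgh : SandwichesVia Γ (LPLE A k R')
      (fun d => ofIntegral A k (g d)) h) :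
    PCSP Γ ∈ PWithOracle (OraclesFor ρ σ h) ∧
    PolyTimeWith (OraclesFor ρ σ h)
      (Formula.enc (ar := ar))
      (fun Ψ y =>
        ((¬ ∃ f, RelaxationSolution Γ.P A k R' g Ψ f) ∧ ¬ Ψ.Satisfiable Γ.P ∧
          y = Data.ofOption none) ∨
        ∃ f, RelaxationSolution Γ.P A k R' g Ψ f ∧
          Ψ.SatisfiedBy Γ.Q (fun i => h (f i)) ∧
          y = Data.ofOption (some (Data.ofList (List.ofFn fun i =>
            Data.ofNat (Encodable.encode (h (f i))))))) := by
  have main := (polyTimeWith_relaxations hA hR Γ.P g h).mono (spec' := fun Ψ y =>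
    ((¬ ∃ f, RelaxationSolution Γ.P A k R' g Ψ f) ∧ ¬ Ψ.Satisfiable Γ.P ∧
      y = Data.ofOption none) ∨
    ∃ f, RelaxationSolution Γ.P A k R' g Ψ f ∧ Ψ.SatisfiedBy Γ.Q (fun i => h (f i)) ∧
      y = Data.ofOption (some (Data.ofList (List.ofFn fun i =>
        Data.ofNat (Encodable.encode (h (f i))))))) (by
    rintro Ψ y (⟨hno, hy⟩ | ⟨f, hf, hy⟩)
    · exact Or.inl ⟨hno, fun hΨ => hno (exists_relaxationSolution hΨ g), hy⟩
    · exact Or.inr ⟨f, hf, hf.satisfiedBy hgh, hy⟩)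
  -- On a yes-instance a rejection would contradict satisfiability of `Ψ_P`; on a no-instance an
  -- output assignment would satisfy `Ψ_Q`.
  refine ⟨main.mem_pWithOracle _ ?_ ?_, main⟩
  · rintro x ⟨Ψ, hΨ, rfl⟩
    refine ⟨Ψ, rfl, fun y hy => ?_⟩
    rcases hy with ⟨-, hno, -⟩ | ⟨f, -, -, rfl⟩
    · exact absurd hΨ hno
    · simp [Data.ofOption]
  · rintro x ⟨Ψ, hΨ, rfl⟩
    refine ⟨Ψ, rfl, fun y hy => ?_⟩
    rcases hy with ⟨-, -, rfl⟩ | ⟨f, -, hf, -⟩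
    · rfl
    · exact absurd ⟨_, hf⟩ hΨ
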